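/- Let $d\ge 1$ and, for $n\ge 1$, let $V_n=\mathbb{Z}^d\cap[1,n]^d$. Let $(g_x)_{x\in V_n}$ be independent standard Gaussian random variables (the disorder), with expectation denoted by $\mathbb{E}$. For $\beta,h>0$, the random field Ising model on $V_n$ with free boundary condition is the random probability measure (Gibbs measure) on $\{-1,1\}^{V_n}$ giving $\sigma$ the mass $$\frac{1}{Z_n(\beta,h)}\exp\Bigl(\beta\sum_{\langle xy\rangle}\sigma_x\sigma_y+h\sum_{x\in V_n}g_x\sigma_x\Bigr),$$ where the first sum is over unordered pairs of nearest neighbours $x,y\in V_n$ and $Z_n(\beta,h)$ is the normalizing constant. Let $\langle\cdot\rangle$ denote averaging over independent configurations $\sigma^1,\sigma^2$ drawn from the Gibbs measure with the same disorder, and let $R_{1,2}=|V_n|^{-1}\sum_{x\in V_n}\sigma^1_x\sigma^2_x$. Then for all $\beta,h>0$ the limit $p(\beta,h)=\lim_{n\to\infty}|V_n|^{-1}\,\mathbb{E}\log Z_n(\beta,h)$ exists and is finite. Let $A$ be the set of all $(\beta,h)\in(0,\infty)^2$ such that $t\mapsto p(\beta,t)$ is not differentiable at $t=h$. Then $A$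 has Lebesgue measure zero, for every $\beta$ the set $\{h:(\beta,h)\in A\}$ is countable, and for every $(\beta,h)\in(0,\infty)^2\setminus A$ there is a constant $q_{\beta,h}\in[-1,1]$ such that $$\lim_{n\to\infty}\mathbb{E}\bigl\langle(R_{1,2}-q_{\beta,h})^2\bigr\rangle=0.$$ -/

import Mathlib

open MeasureTheory ProbabilityTheory Filter Topology

namespace RFIM

/-- The box `V_n = ℤ^d ∩ [1,n]^d`. -/
noncomputable def box (d n : ℕ) : Finset (Fin d → ℤ) :=
  Fintype.piFinset fun _ => Finset.Icc (1 : ℤ) (n : ℤ)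

/-- The nearest-neighbour graph on `V_n` (free boundary: only bonds inside the box). -/
def boxGraph (d n : ℕ) : SimpleGraph (box d n) where
  Adj x y := ∑ i, |x.1 i - y.1 i| = 1
  symm := ⟨fun x y h => by simpa only [abs_sub_comm] using h⟩
  loopless := ⟨fun x h => by simp at h⟩

instance (d n : ℕ) : DecidableRel (boxGraph d n).Adj := fun x y =>
  inferInstanceAs (Decidable (∑ i, |x.1 i - y.1 i| = 1))

/-- Spin configurations `{-1,1}^{V_n}`; `ℤˣ` is the two-element set `{1,-1}`. -/
abbrev Config (d n : ℕ) : Type := box d n → ℤˣ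

/-- The real value `σ_x ∈ {-1,1}` of the spin at `x`. -/
def spin {d n : ℕ} (σ : Config d n) (x : box d n) : ℝ := ((σ x : ℤ) : ℝ)

/-- The product `σ_x σ_y` for an unordered pair `{x,y}`. -/
def bond {d n : ℕ} (σ : Config d n) : Sym2 (box d n) → ℝ :=
  Sym2.lift ⟨fun x y => spin σ x * spin σ y, fun _ _ => mul_comm _ _⟩

/-- The exponent `β ∑_{⟨xy⟩} σ_x σ_y + h ∑_x g_x σ_x`; each bond is counted once. -/
noncomputable def energy {d n : ℕ} (β h : ℝ) (g : box d n → ℝ) (σ : Config d n) : ℝ :=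
  β * (∑ e ∈ (boxGraph d n).edgeFinset, bond σ e) + h * (∑ x, g x * spin σ x)

/-- The partition function `Z_n(β,h)`. -/
noncomputable def partitionFn {d n : ℕ} (β h : ℝ) (g : box d n → ℝ) : ℝ :=
  ∑ σ : Config d n, Real.exp (energy β h g σ)

/-- The mass that the Gibbs measure with disorder `g` gives to `σ`. -/
noncomputable def gibbs {d n : ℕ} (β h : ℝ) (g : box d n → ℝ) (σ : Config d n) : ℝ :=
  Real.exp (energy β h g σ) / partitionFn β h g

/-- The average `⟨f(σ¹,σ²)⟩` over two independent replicas drawn from the Gibbs measure. -/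
noncomputable def replicaAvg {d n : ℕ} (β h : ℝ) (g : box d n → ℝ)
    (f : Config d n → Config d n → ℝ) : ℝ :=
  ∑ σ₁ : Config d n, ∑ σ₂ : Config d n, f σ₁ σ₂ * (gibbs β h g σ₁ * gibbs β h g σ₂)

/-- The overlap `R_{1,2} = |V_n|⁻¹ ∑_x σ¹_x σ²_x`. -/
noncomputable def overlap {d n : ℕ} (σ₁ σ₂ : Config d n) : ℝ :=
  (∑ x, spin σ₁ x * spin σ₂ x) / ((box d n).card : ℝ)

/-- The law of the disorder on `V_n`: independent standard Gaussian variables. -/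
noncomputable def disorder (d n : ℕ) : Measure (box d n → ℝ) :=
  Measure.pi fun _ => gaussianReal 0 1

/-- The mean free energy per site `p_n(β,h) = E(log Z_n(β,h)) / |V_n|`. -/
noncomputable def meanFreeEnergy (d n : ℕ) (β h : ℝ) : ℝ :=
  ∫ g, Real.log (partitionFn β h g) / ((box d n).card : ℝ) ∂(disorder d n)

/-- `E⟨(R_{1,2} - q)²⟩`. -/
noncomputable def overlapDeviation (d n : ℕ) (β h q : ℝ) : ℝ :=
  ∫ g, replicaAvg β h g (fun σ₁ σ₂ => (overlap σ₁ σ₂ - q) ^ 2) ∂(disorder d n)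

end RFIM

/-! Write N = |V_n|, m_x = ⟨σ_x⟩, M = `fieldEnergy` = N⁻¹ ∑ g_x m_x (the h-derivative of the free
energy per site) and Q = `meanOverlap` = N⁻¹ ∑ m_x² = ⟨R_{1,2}⟩.

The free energy per site is convex in (β,h), and an Efron–Stein bound gives it fluctuations of order
N^{-1/2}. Cutting boxes into blocks shows that its mean converges. Where the limit p is
differentiable in h with derivative L, convexity forces M → L in L¹
(`tendsto_integral_abs_fieldEnergy_sub`).

Gaussian integration by parts gives E M = h(1 - E Q), so E Q → q := 1 - L/h. It also gives E(MQ) = h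
E((1 - Q)Q) plus a remainder involving the truncated correlations ⟨σ_xσ_y⟩ - m_x m_y. By FKG these
are nonnegative, so the remainder is at most a multiple of their total. That total is itself
computed by parts: h times its mean is E[(∑ g_y)(∑ m_x)] ≤ N · N^{1/2}
(`mul_sum_integral_trunc_le`), and the remainder is O(N^{-1/2}). Since E(MQ) is also close to L E Q
= h(1 - q) E Q, it follows that E Q² → q², hence Q → q in L². The thermal fluctuation ⟨R_{1,2}²⟩ -
Q² is again at most twice the total truncated correlation over N² (`replicaAvg_overlap_sub_sq_le`).

A convex function of one variable has countably many kinks, so every β-section of A is countable.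
Joint convexity makes p continuous, hence A measurable, and Fubini makes it null. -/

namespace RFIM

/-! ### Convexity and derivatives of log-sum-exp -/

section LogSumExp

variable {ι : Type*} [Fintype ι]

lemma sum_exp_pos [Nonempty ι] (a : ι → ℝ) : 0 < ∑ i, Real.exp (a i) :=
  Finset.sum_pos (fun _ _ => Real.exp_pos _) Finset.univ_nonempty

/-- The gradient inequality for the convex function `a ↦ log ∑ exp (a i)`. -/
lemma gradient_le_log_sum_exp_sub [Nonempty ι] (a b : ι → ℝ) :
    ∑ i, (b i - a i) * (Real.exp (a i) / ∑ j, Real.exp (a j)) ≤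
      Real.log (∑ i, Real.exp (b i)) - Real.log (∑ i, Real.exp (a i)) := by
  set Z := ∑ j, Real.exp (a j) with hZ
  have hZ0 : 0 < Z := sum_exp_pos a
  set c := ∑ i, (b i - a i) * (Real.exp (a i) / Z) with hc
  have hw : ∑ i, Real.exp (a i) / Z = 1 := by
    rw [← Finset.sum_div, div_self hZ0.ne']
  -- Jensen by hand: 1 + u ≤ exp u at u = b i - a i - c; the linear terms cancel in the sum because
  -- c is the Gibbs mean of b - a.
  have key : Z * Real.exp c ≤ ∑ i, Real.exp (b i) := by
    have h1 : ∀ i, Real.exp (a i) * Real.exp c * (b i - a i - c + 1) ≤ Real.exp (b i) := by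
      intro i
      have h := Real.add_one_le_exp (b i - a i - c)
      calc _ ≤ Real.exp (a i) * Real.exp c * Real.exp (b i - a i - c) := by gcongr
        _ = Real.exp (b i) := by rw [← Real.exp_add, ← Real.exp_add]; congr 1; ring
    have h2 : ∑ i, Real.exp (a i) * Real.exp c * (b i - a i - c + 1) = Z * Real.exp c := by
      have h3 : ∑ i, Real.exp (a i) * Real.exp c * (b i - a i - c + 1)
          = Z * Real.exp c * (∑ i, ((b i - a i) * (Real.exp (a i) / Z)
              + (1 - c) * (Real.exp (a i) / Z))) := by
        rw [Finset.mul_sum]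
        refine Finset.sum_congr rfl fun i _ => ?_
        field_simp
        ring
      rw [h3, Finset.sum_add_distrib, ← Finset.mul_sum, hw, ← hc]
      ring
    rw [← h2]
    exact Finset.sum_le_sum fun i _ => h1 i
  have h4 := Real.log_le_log (by positivity) key
  rw [Real.log_mul hZ0.ne' (Real.exp_pos c).ne', Real.log_exp] at h4
  linarith

lemma log_sum_exp_sub_le [Nonempty ι] (a b : ι → ℝ) {C : ℝ} (h : ∀ i, a i - b i ≤ C) :
    Real.log (∑ i, Real.exp (a i)) - Real.log (∑ i, Real.exp (b i)) ≤ C := by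
  have h1 := gradient_le_log_sum_exp_sub a b
  have hZ0 : 0 < ∑ j, Real.exp (a j) := sum_exp_pos a
  have h2 : ∑ i, (-C) * (Real.exp (a i) / ∑ j, Real.exp (a j)) ≤
      ∑ i, (b i - a i) * (Real.exp (a i) / ∑ j, Real.exp (a j)) :=
    Finset.sum_le_sum fun i _ => mul_le_mul_of_nonneg_right (by linarith [h i]) (by positivity)
  rw [← Finset.mul_sum, ← Finset.sum_div, div_self hZ0.ne'] at h2
  linarith

lemma abs_log_sum_exp_sub_le [Nonempty ι] (a b : ι → ℝ) {C : ℝ} (h : ∀ i, |a i - b i| ≤ C) :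
    |Real.log (∑ i, Real.exp (a i)) - Real.log (∑ i, Real.exp (b i))| ≤ C := by
  rw [abs_le]
  constructor
  · have := log_sum_exp_sub_le b a (C := C) fun i => by
      have := (abs_le.1 (h i)).1; linarith
    linarith
  · exact log_sum_exp_sub_le a b fun i => (abs_le.1 (h i)).2

/-- The gradient inequalities from the common point s a + t b towards a and towards b are averaged;
their first-order terms cancel. -/
lemma log_sum_exp_convex [Nonempty ι] (a b : ι → ℝ) {s t : ℝ} (hs : 0 ≤ s) (ht : 0 ≤ t)
    (hst : s + t = 1) :
    Real.log (∑ i, Real.exp (s * a i + t * b i)) ≤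
      s * Real.log (∑ i, Real.exp (a i)) + t * Real.log (∑ i, Real.exp (b i)) := by
  set c : ι → ℝ := fun i => s * a i + t * b i
  have h1 := mul_le_mul_of_nonneg_left (gradient_le_log_sum_exp_sub c a) hs
  have h2 := mul_le_mul_of_nonneg_left (gradient_le_log_sum_exp_sub c b) ht
  have h3 : s * ∑ i, (a i - c i) * (Real.exp (c i) / ∑ j, Real.exp (c j)) +
      t * ∑ i, (b i - c i) * (Real.exp (c i) / ∑ j, Real.exp (c j)) = 0 := by
    rw [Finset.mul_sum, Finset.mul_sum, ← Finset.sum_add_distrib]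
    refine Finset.sum_eq_zero fun i _ => ?_
    have : s * (a i - c i) + t * (b i - c i) = 0 := by
      have : s * (a i - c i) + t * (b i - c i) = (s * a i + t * b i) - (s + t) * c i := by ring
      rw [this, hst]; simp [c]
    linear_combination (Real.exp (c i) / ∑ j, Real.exp (c j)) * this
  have h4 : ∀ x : ℝ, s * x + t * x = x := fun x => by rw [← add_mul, hst, one_mul]
  have h5 := h4 (Real.log (∑ i, Real.exp (c i)))
  show Real.log (∑ i, Real.exp (c i)) ≤ _
  linarith

/-- Derivative of a Gibbs average along a linear perturbation of the energy. -/
lemma hasDerivAt_gibbs_average [Nonempty ι] (f a b : ι → ℝ) (t : ℝ) :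
    HasDerivAt
      (fun t : ℝ => ∑ i, f i * (Real.exp (a i + t * b i) / ∑ j, Real.exp (a j + t * b j)))
      (∑ i, f i * b i * (Real.exp (a i + t * b i) / ∑ j, Real.exp (a j + t * b j)) -
        (∑ i, f i * (Real.exp (a i + t * b i) / ∑ j, Real.exp (a j + t * b j))) *
          ∑ i, b i * (Real.exp (a i + t * b i) / ∑ j, Real.exp (a j + t * b j))) t := by
  have hE : ∀ i, HasDerivAt (fun t : ℝ => Real.exp (a i + t * b i))
      (b i * Real.exp (a i + t * b i)) t := fun i => by
    have h := (((hasDerivAt_id t).mul_const (b i)).const_add (a i)).exp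
    simpa [mul_comm] using h
  have hZ : HasDerivAt (fun t : ℝ => ∑ j, Real.exp (a j + t * b j))
      (∑ j, b j * Real.exp (a j + t * b j)) t := by
    exact HasDerivAt.fun_sum fun i _ => hE i
  have hN : HasDerivAt (fun t : ℝ => ∑ j, f j * Real.exp (a j + t * b j))
      (∑ j, f j * (b j * Real.exp (a j + t * b j))) t := by
    exact HasDerivAt.fun_sum fun i _ => (hE i).const_mul (f i)
  have hZ0 : ∑ j, Real.exp (a j + t * b j) ≠ 0 := (sum_exp_pos _).ne'
  have h := hN.fun_div hZ hZ0
  have e1 : ∀ (F : ι → ℝ) (t : ℝ),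
      ∑ i, F i * (Real.exp (a i + t * b i) / ∑ j, Real.exp (a j + t * b j)) =
      (∑ i, F i * Real.exp (a i + t * b i)) / ∑ j, Real.exp (a j + t * b j) := by
    intro F t
    rw [Finset.sum_div]
    exact Finset.sum_congr rfl fun i _ => by ring
  simp_rw [e1]
  refine h.congr_deriv ?_
  have e2 : ∑ i, f i * (b i * Real.exp (a i + t * b i)) =
      ∑ i, f i * b i * Real.exp (a i + t * b i) :=
    Finset.sum_congr rfl fun i _ => by ring
  rw [e2, sub_div, pow_two, mul_div_mul_right _ _ hZ0, mul_div_mul_comm]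

end LogSumExp

/-! ### Gaussian integration by parts -/

section GaussianIntegration

lemma hasDerivAt_gaussianPDFReal (x : ℝ) :
    HasDerivAt (gaussianPDFReal 0 1) (-(x * gaussianPDFReal 0 1 x)) x := by
  have h : HasDerivAt (fun x : ℝ => (Real.sqrt (2 * Real.pi * (1 : NNReal)))⁻¹ *
      Real.exp (-(x - 0) ^ 2 / (2 * (1 : NNReal)))) _ x :=
    ((((((hasDerivAt_id x).sub_const 0).pow 2).neg).div_const
      (2 * ((1 : NNReal) : ℝ))).exp).const_mul _
  rw [gaussianPDFReal_def]
  convert h using 1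
  simp
  ring

lemma integrable_gaussianReal_iff {f : ℝ → ℝ} :
    Integrable f (gaussianReal 0 1) ↔ Integrable (fun x => gaussianPDFReal 0 1 x * f x) := by
  rw [gaussianReal_of_var_ne_zero _ one_ne_zero,
    integrable_withDensity_iff_integrable_smul' (measurable_gaussianPDF 0 1)
      (ae_of_all _ fun x => gaussianPDF_lt_top)]
  simp [toReal_gaussianPDF]

lemma integrable_id_gaussianReal : Integrable (fun x : ℝ => x) (gaussianReal 0 1) := by
  have h : MemLp (id : ℝ → ℝ) 1 (gaussianReal 0 1) := by
    simpa using memLp_id_gaussianReal (μ := 0) (v := 1) 1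
  exact memLp_one_iff_integrable.1 h

/-- Gaussian integration by parts on the line. -/
lemma integral_id_mul_gaussianReal {f f' : ℝ → ℝ} {C C' : ℝ} (hf : ∀ x, HasDerivAt f (f' x) x)
    (hC : ∀ x, |f x| ≤ C) (hC' : ∀ x, |f' x| ≤ C') :
    ∫ x, x * f x ∂gaussianReal 0 1 = ∫ x, f' x ∂gaussianReal 0 1 := by
  have hfc : Continuous f := continuous_iff_continuousAt.2 fun x => (hf x).continuousAt
  have hfm : Measurable f' := by
    have : f' = deriv f := funext fun x => (hf x).deriv.symm
    rw [this]; exact measurable_deriv f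
  have i1 : Integrable f (gaussianReal 0 1) :=
    Integrable.of_bound hfc.aestronglyMeasurable C (ae_of_all _ fun x => by simpa using hC x)
  have i2 : Integrable f' (gaussianReal 0 1) :=
    Integrable.of_bound hfm.aestronglyMeasurable C' (ae_of_all _ fun x => by simpa using hC' x)
  have i3 : Integrable (fun x => x * f x) (gaussianReal 0 1) :=
    integrable_id_gaussianReal.mul_bdd (c := C) hfc.aestronglyMeasurable
      (ae_of_all _ fun x => by simpa using hC x)
  rw [integrable_gaussianReal_iff] at i1 i2 i3
  -- The density φ satisfies φ' = -xφ; integrability of the products removes the boundary terms.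
  have h := integral_mul_deriv_eq_deriv_mul_of_integrable (u := f) (v := gaussianPDFReal 0 1)
    (u' := f') (v' := fun x => -(x * gaussianPDFReal 0 1 x)) (fun x _ => hf x)
    (fun x _ => hasDerivAt_gaussianPDFReal x)
    (i3.neg.congr (ae_of_all _ fun x => by simp; ring))
    (i2.congr (ae_of_all _ fun x => by simp; ring))
    (i1.congr (ae_of_all _ fun x => by simp; ring))
  rw [integral_gaussianReal_eq_integral_smul one_ne_zero,
    integral_gaussianReal_eq_integral_smul one_ne_zero]
  have e1 : ∫ x, gaussianPDFReal 0 1 x • (x * f x) =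
      -∫ x, f x * -(x * gaussianPDFReal 0 1 x) := by
    rw [← integral_neg]; congr 1; ext x; simp; ring
  have e2 : ∫ x, gaussianPDFReal 0 1 x • f' x = ∫ x, f' x * gaussianPDFReal 0 1 x := by
    congr 1; ext x; simp; ring
  rw [e1, e2, h, neg_neg]

variable {ι : Type*} [Fintype ι]

lemma memLp_eval_gaussian (i : ι) :
    MemLp (fun g : ι → ℝ => g i) 2 (Measure.pi fun _ : ι => gaussianReal 0 1) := by
  have h := measurePreserving_eval (fun _ : ι => gaussianReal 0 1) i
  have h2 : MemLp (id : ℝ → ℝ) 2 (gaussianReal 0 1) := by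
    simpa using memLp_id_gaussianReal (μ := 0) (v := 1) 2
  exact h2.comp_measurePreserving h

lemma integrable_eval_gaussian (i : ι) :
    Integrable (fun g : ι → ℝ => g i) (Measure.pi fun _ : ι => gaussianReal 0 1) :=
  (memLp_eval_gaussian i).integrable one_le_two

variable [DecidableEq ι]

/-- Resampling one coordinate preserves a product probability measure. -/
lemma measurePreserving_update (μ : Measure ℝ) [IsProbabilityMeasure μ] (i : ι) :
    MeasurePreserving (fun p : (ι → ℝ) × ℝ => Function.update p.1 i p.2)
      ((Measure.pi fun _ : ι => μ).prod μ) (Measure.pi fun _ : ι => μ) := by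
  have hm : Measurable (fun p : (ι → ℝ) × ℝ => Function.update p.1 i p.2) := by
    refine measurable_pi_lambda _ fun j => ?_
    by_cases h : j = i
    · subst h; simpa using measurable_snd
    · simp only [Function.update_of_ne h]; fun_prop
  refine ⟨hm, ?_⟩
  symm
  refine Measure.pi_eq fun s hs => ?_
  rw [Measure.map_apply hm (MeasurableSet.univ_pi hs)]
  have : (fun p : (ι → ℝ) × ℝ => Function.update p.1 i p.2) ⁻¹' (Set.univ.pi s) =
      (Set.univ.pi (Function.update s i Set.univ)) ×ˢ (s i) := by
    ext ⟨g, t⟩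
    simp only [Set.mem_preimage, Set.mem_pi, Set.mem_univ, true_imp_iff, Set.mem_prod]
    constructor
    · intro h
      refine ⟨fun j => ?_, by simpa using h i⟩
      by_cases hj : j = i
      · subst hj; simp
      · simpa [hj] using h j
    · rintro ⟨h1, h2⟩ j
      by_cases hj : j = i
      · subst hj; simpa using h2
      · simpa [hj] using h1 j
  rw [this, Measure.prod_prod, Measure.pi_pi, ← Finset.mul_prod_erase _ _ (Finset.mem_univ i),
    ← Finset.mul_prod_erase _ (fun j => μ (s j)) (Finset.mem_univ i)]
  have e : ∏ j ∈ Finset.univ.erase i, μ (Function.update s i Set.univ j) =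
      ∏ j ∈ Finset.univ.erase i, μ (s j) :=
    Finset.prod_congr rfl fun j hj => by rw [Function.update_of_ne (Finset.ne_of_mem_erase hj)]
  rw [e, Function.update_self, measure_univ, one_mul, mul_comm]

/-- Fubini after resampling. The outer integral still runs over all coordinates, the i-th being
overwritten, so the index type is never split. -/
lemma integral_pi_eq_integral_update (μ : Measure ℝ) [IsProbabilityMeasure μ] (i : ι)
    {f : (ι → ℝ) → ℝ} (hf : Integrable f (Measure.pi fun _ : ι => μ)) :
    ∫ g, f g ∂(Measure.pi fun _ : ι => μ) =
      ∫ g, ∫ t, f (Function.update g i t) ∂μ ∂(Measure.pi fun _ : ι => μ) := by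
  have h := measurePreserving_update μ i
  have h1 : ∫ p, f (Function.update p.1 i p.2) ∂((Measure.pi fun _ : ι => μ).prod μ) =
      ∫ g, f g ∂(Measure.pi fun _ : ι => μ) := by
    conv_rhs => rw [← h.map_eq]
    rw [integral_map h.measurable.aemeasurable]
    rw [h.map_eq]; exact hf.aestronglyMeasurable
  rw [← h1, integral_prod]
  exact h.integrable_comp_of_integrable hf

lemma integrable_update (μ : Measure ℝ) [IsProbabilityMeasure μ] (i : ι)
    {f : (ι → ℝ) → ℝ} (hf : Integrable f (Measure.pi fun _ : ι => μ)) :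
    Integrable (fun p : (ι → ℝ) × ℝ => f (Function.update p.1 i p.2))
      ((Measure.pi fun _ : ι => μ).prod μ) :=
  (measurePreserving_update μ i).integrable_comp_of_integrable hf

/-- Gaussian integration by parts in one coordinate of a product. -/
lemma integral_eval_mul_gaussian (i : ι) {f f' : (ι → ℝ) → ℝ} {C C' : ℝ}
    (hfm : Measurable f) (hfm' : Measurable f')
    (hf : ∀ g t, HasDerivAt (fun t => f (Function.update g i t)) (f' (Function.update g i t)) t)
    (hC : ∀ x, |f x| ≤ C) (hC' : ∀ x, |f' x| ≤ C') :
    ∫ g, g i * f g ∂(Measure.pi fun _ : ι => gaussianReal 0 1) =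
      ∫ g, f' g ∂(Measure.pi fun _ : ι => gaussianReal 0 1) := by
  rw [integral_pi_eq_integral_update (gaussianReal 0 1) i,
    integral_pi_eq_integral_update (gaussianReal 0 1) i (f := f')]
  · congr 1
    ext g
    simp only [Function.update_self]
    exact integral_id_mul_gaussianReal (hf g) (fun x => hC _) (fun x => hC' _)
  · exact Integrable.of_bound hfm'.aestronglyMeasurable C'
      (ae_of_all _ fun x => by simpa using hC' x)
  · exact (integrable_eval_gaussian i).mul_bdd (c := C) hfm.aestronglyMeasurable
      (ae_of_all _ fun x => by simpa using hC x)

end GaussianIntegration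

/-! ### Efron–Stein variance bound for Lipschitz functions -/

section Variance

variable {ι : Type*} [Fintype ι]

/-- `f` is `c`-Lipschitz for the `ℓ¹` distance. -/
def L1Lipschitz (c : ℝ) (f : (ι → ℝ) → ℝ) : Prop :=
  ∀ g g', |f g - f g'| ≤ c * ∑ i, |g i - g' i|

lemma L1Lipschitz.continuous {c : ℝ} {f : (ι → ℝ) → ℝ} (hf : L1Lipschitz c f) :
    Continuous f := by
  rw [continuous_iff_continuousAt]
  intro g
  rw [ContinuousAt, tendsto_iff_dist_tendsto_zero]
  have h : Tendsto (fun g' : ι → ℝ => c * ∑ i, |g' i - g i|) (𝓝 g) (𝓝 0) := by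
    have : Continuous (fun g' : ι → ℝ => c * ∑ i, |g' i - g i|) := by fun_prop
    simpa using this.tendsto g
  exact squeeze_zero (fun _ => dist_nonneg) (fun g' => by rw [Real.dist_eq]; exact hf g' g) h

lemma L1Lipschitz.memLp {c : ℝ} {f : (ι → ℝ) → ℝ} (hf : L1Lipschitz c f) :
    MemLp f 2 (Measure.pi fun _ : ι => gaussianReal 0 1) := by
  have h1 : MemLp (fun g : ι → ℝ => |f 0| + c * ∑ i, |g i|) 2
      (Measure.pi fun _ : ι => gaussianReal 0 1) := by
    have h2 : MemLp (fun g : ι → ℝ => ∑ i, |g i|) 2 (Measure.pi fun _ : ι => gaussianReal 0 1) :=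
      memLp_finsetSum Finset.univ fun i _ => (memLp_eval_gaussian i).abs
    have h3 : MemLp (fun g : ι → ℝ => c * ∑ i, |g i|) 2
      (Measure.pi fun _ : ι => gaussianReal 0 1) := h2.const_mul c
    have h4 : MemLp (fun _ : ι → ℝ => |f 0|) 2 (Measure.pi fun _ : ι => gaussianReal 0 1) :=
      memLp_const _
    exact h4.add h3
  refine h1.mono hf.continuous.aestronglyMeasurable (ae_of_all _ fun g => ?_)
  have h2 := hf g 0
  simp only [Pi.zero_apply, sub_zero] at h2
  rw [Real.norm_eq_abs, Real.norm_eq_abs]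
  refine le_trans ?_ (le_abs_self _)
  calc |f g| = |(f g - f 0) + f 0| := by ring_nf
    _ ≤ |f g - f 0| + |f 0| := abs_add_le _ _
    _ ≤ _ := by linarith

variable [DecidableEq ι]

/-- Averaging out one Gaussian coordinate. -/
noncomputable def averageCoord (i : ι) (f : (ι → ℝ) → ℝ) (g : ι → ℝ) : ℝ :=
  ∫ t, f (Function.update g i t) ∂gaussianReal 0 1

lemma L1Lipschitz.abs_update_sub_le {c : ℝ} {f : (ι → ℝ) → ℝ} (hf : L1Lipschitz c f) (i : ι)
    (g : ι → ℝ) (s t : ℝ) :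
    |f (Function.update g i s) - f (Function.update g i t)| ≤ c * |s - t| := by
  refine (hf _ _).trans_eq ?_
  rw [Finset.sum_eq_single i]
  · simp
  · intro j _ hj; simp [hj]
  · simp

lemma L1Lipschitz.memLp_update {c : ℝ} {f : (ι → ℝ) → ℝ} (hf : L1Lipschitz c f) (i : ι)
    (g : ι → ℝ) : MemLp (fun t => f (Function.update g i t)) 2 (gaussianReal 0 1) := by
  have hid : MemLp (fun t : ℝ => t) 2 (gaussianReal 0 1) := by
    have h : MemLp (id : ℝ → ℝ) 2 (gaussianReal 0 1) := by
      simpa using memLp_id_gaussianReal (μ := 0) (v := 1) 2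
    exact h
  have h1 : MemLp (fun t : ℝ => |f (Function.update g i 0)| + c * |t|) 2 (gaussianReal 0 1) := by
    have h2 : MemLp (fun t : ℝ => c * |t|) 2 (gaussianReal 0 1) := hid.abs.const_mul c
    have h3 : MemLp (fun _ : ℝ => |f (Function.update g i 0)|) 2 (gaussianReal 0 1) :=
      memLp_const _
    exact h3.add h2
  have hc : Continuous fun t => f (Function.update g i t) :=
    hf.continuous.comp (continuous_const.update i continuous_id)
  refine h1.mono hc.aestronglyMeasurable (ae_of_all _ fun t => ?_)
  have h2 := hf.abs_update_sub_le i g t 0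
  rw [sub_zero] at h2
  rw [Real.norm_eq_abs, Real.norm_eq_abs]
  refine le_trans ?_ (le_abs_self _)
  have h3 := abs_add_le (f (Function.update g i t) - f (Function.update g i 0))
    (f (Function.update g i 0))
  rw [sub_add_cancel] at h3
  linarith

/-- Keeping the same constant is what lets the Efron–Stein induction continue with the averaged
function. -/
lemma L1Lipschitz.averageCoord {c : ℝ} (hc : 0 ≤ c) {f : (ι → ℝ) → ℝ} (hf : L1Lipschitz c f)
    (i : ι) : L1Lipschitz c (averageCoord i f) := by
  intro g g'
  have i1 := (hf.memLp_update i g).integrable one_le_two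
  have i2 := (hf.memLp_update i g').integrable one_le_two
  rw [RFIM.averageCoord, RFIM.averageCoord, ← integral_sub i1 i2]
  have h := norm_integral_le_of_norm_le_const (μ := gaussianReal 0 1)
    (f := fun t => f (Function.update g i t) - f (Function.update g' i t))
    (C := c * ∑ j, |g j - g' j|) (ae_of_all _ fun t => by
      rw [Real.norm_eq_abs]
      refine (hf _ _).trans ?_
      refine mul_le_mul_of_nonneg_left (Finset.sum_le_sum fun j _ => ?_) hc
      by_cases hj : j = i
      · subst hj; simp
      · simp [hj])
  simpa using h

lemma averageCoord_update_self {κ : Type*} [DecidableEq κ] (i : κ) (f : (κ → ℝ) → ℝ)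
    (g : κ → ℝ) (t : ℝ) :
    averageCoord i f (Function.update g i t) = averageCoord i f g := by
  simp [averageCoord]

lemma integral_averageCoord (i : ι) {f : (ι → ℝ) → ℝ}
    (hf : Integrable f (Measure.pi fun _ : ι => gaussianReal 0 1)) :
    ∫ g, averageCoord i f g ∂(Measure.pi fun _ : ι => gaussianReal 0 1) =
      ∫ g, f g ∂(Measure.pi fun _ : ι => gaussianReal 0 1) :=
  (integral_pi_eq_integral_update (gaussianReal 0 1) i hf).symm

lemma integral_sq_gaussianReal : ∫ t : ℝ, t ^ 2 ∂gaussianReal 0 1 = 1 := by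
  have h := variance_fun_id_gaussianReal (μ := 0) (v := 1)
  rw [variance_eq_integral (by fun_prop)] at h
  simpa using h

/-- With the other coordinates frozen this is a one-dimensional variance, at most the second moment
about the value at 0, hence at most c² E t² = c². -/
lemma L1Lipschitz.integral_sub_averageCoord_sq_le {c : ℝ} (hc : 0 ≤ c) {f : (ι → ℝ) → ℝ}
    (hf : L1Lipschitz c f) (i : ι) :
    ∫ g, (f g - RFIM.averageCoord i f g) ^ 2 ∂(Measure.pi fun _ : ι => gaussianReal 0 1) ≤
      c ^ 2 := by
  have hint : Integrable (fun g => (f g - RFIM.averageCoord i f g) ^ 2)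
      (Measure.pi fun _ : ι => gaussianReal 0 1) :=
    (hf.memLp.sub (hf.averageCoord hc i).memLp).integrable_sq
  rw [integral_pi_eq_integral_update (gaussianReal 0 1) i hint]
  have key : ∀ g : ι → ℝ, ∫ t, (f (Function.update g i t) -
      RFIM.averageCoord i f (Function.update g i t)) ^ 2 ∂gaussianReal 0 1 ≤ c ^ 2 := by
    intro g
    have hL := hf.memLp_update i g
    have hsq : Integrable (fun t : ℝ => t ^ 2) (gaussianReal 0 1) := by
      have h : MemLp (id : ℝ → ℝ) 2 (gaussianReal 0 1) := by
        simpa using memLp_id_gaussianReal (μ := 0) (v := 1) 2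
      exact h.integrable_sq
    have h1 : ∫ t, (f (Function.update g i t) -
        RFIM.averageCoord i f (Function.update g i t)) ^ 2 ∂gaussianReal 0 1 =
        Var[fun t => f (Function.update g i t); gaussianReal 0 1] := by
      rw [variance_eq_integral hL.aestronglyMeasurable.aemeasurable]
      simp_rw [averageCoord_update_self]
      rfl
    rw [h1, ← variance_sub_const hL.aestronglyMeasurable (f (Function.update g i 0))]
    refine (variance_le_expectation_sq
      (hL.aestronglyMeasurable.sub aestronglyMeasurable_const)).trans ?_
    calc _ ≤ ∫ t, c ^ 2 * t ^ 2 ∂gaussianReal 0 1 := by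
          refine integral_mono (hL.sub (memLp_const _)).integrable_sq (hsq.const_mul _) fun t => ?_
          have h2 := hf.abs_update_sub_le i g t 0
          rw [sub_zero] at h2
          have h3 := pow_le_pow_left₀ (abs_nonneg _) h2 2
          rwa [sq_abs, mul_pow, sq_abs] at h3
      _ = c ^ 2 := by rw [integral_const_mul, integral_sq_gaussianReal, mul_one]
  have h4 := integral_mono (μ := Measure.pi fun _ : ι => gaussianReal 0 1)
    ((integrable_update (gaussianReal 0 1) i hint).integral_prod_left) (integrable_const (c ^ 2))
    key
  simpa using h4

/-- As functions of the i-th coordinate alone, the second factor is constant and the first has mean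
zero. -/
lemma integral_cross_averageCoord_eq_zero {c : ℝ} (hc : 0 ≤ c) {f : (ι → ℝ) → ℝ}
    (hf : L1Lipschitz c f) (i : ι) (m : ℝ) :
    ∫ g, (f g - averageCoord i f g) * (averageCoord i f g - m)
      ∂(Measure.pi fun _ : ι => gaussianReal 0 1) = 0 := by
  have hint : Integrable (fun g => (f g - averageCoord i f g) * (averageCoord i f g - m))
      (Measure.pi fun _ : ι => gaussianReal 0 1) :=
    (hf.memLp.sub (hf.averageCoord hc i).memLp).integrable_mul
      ((hf.averageCoord hc i).memLp.sub (memLp_const m))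
  rw [integral_pi_eq_integral_update (gaussianReal 0 1) i hint]
  refine integral_eq_zero_of_ae (ae_of_all _ fun g => ?_)
  simp_rw [averageCoord_update_self]
  rw [integral_mul_const, integral_sub ((hf.memLp_update i g).integrable one_le_two)
    (integrable_const _)]
  simp [averageCoord]

lemma eq_of_forall_update_eq {f : (ι → ℝ) → ℝ} (h : ∀ i g t, f (Function.update g i t) = f g)
    (g : ι → ℝ) : f g = f 0 := by
  have : ∀ s : Finset ι, f (s.piecewise g 0) = f 0 := by
    intro s
    induction s using Finset.induction_on with
    | empty => simp
    | insert j s _ ih => rw [Finset.piecewise_insert, h, ih]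
  simpa using this Finset.univ

/-- Efron–Stein bound for functions depending on the coordinates in `s`. -/
lemma integral_sub_sq_le_of_dependsOn {c : ℝ} (hc : 0 ≤ c) (s : Finset ι) :
    ∀ f : (ι → ℝ) → ℝ, L1Lipschitz c f → (∀ i ∉ s, ∀ g t, f (Function.update g i t) = f g) →
    ∫ g, (f g - ∫ g', f g' ∂(Measure.pi fun _ : ι => gaussianReal 0 1)) ^ 2
      ∂(Measure.pi fun _ : ι => gaussianReal 0 1) ≤ c ^ 2 * s.card := by
  induction s using Finset.induction_on with
  | empty =>
    intro f _ hs
    have h : ∀ g, f g = f 0 := eq_of_forall_update_eq fun i => hs i (Finset.notMem_empty i)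
    simp_rw [h]
    simp
  | insert i s hi ih =>
    intro f hf hs
    have hf' := hf.averageCoord hc i
    have hdep : ∀ j ∉ s, ∀ g t,
        averageCoord i f (Function.update g j t) = averageCoord i f g := by
      intro j hj g t
      by_cases hji : j = i
      · subst hji; exact averageCoord_update_self _ _ _ _
      · rw [averageCoord, averageCoord]
        congr 1
        ext u
        rw [Function.update_comm hji, hs j (by simp [hji, hj])]
    have h1 := ih _ hf' hdep
    rw [integral_averageCoord i (hf.memLp.integrable one_le_two)] at h1
    set m := ∫ g', f g' ∂(Measure.pi fun _ : ι => gaussianReal 0 1)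
    have h2 := hf.integral_sub_averageCoord_sq_le hc i
    have h3 := integral_cross_averageCoord_eq_zero hc hf i m
    -- Pythagoras: coordinate i contributes at most c², and the averaged function, with the same
    -- mean m, depends only on s.
    have e : ∀ g, (f g - m) ^ 2 = (f g - averageCoord i f g) ^ 2 + (averageCoord i f g - m) ^ 2 +
        2 * ((f g - averageCoord i f g) * (averageCoord i f g - m)) := fun g => by ring
    have i1 : Integrable (fun g => (f g - averageCoord i f g) ^ 2)
      (Measure.pi fun _ : ι => gaussianReal 0 1) := (hf.memLp.sub hf'.memLp).integrable_sq
    have i2 : Integrable (fun g => (averageCoord i f g - m) ^ 2)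
      (Measure.pi fun _ : ι => gaussianReal 0 1) :=
      (hf'.memLp.sub (memLp_const m)).integrable_sq
    have i3 : Integrable (fun g => (f g - averageCoord i f g) * (averageCoord i f g - m))
      (Measure.pi fun _ : ι => gaussianReal 0 1) :=
      (hf.memLp.sub hf'.memLp).integrable_mul (hf'.memLp.sub (memLp_const m))
    simp_rw [e]
    have i12 : Integrable (fun g => (f g - averageCoord i f g) ^ 2 +
      (averageCoord i f g - m) ^ 2) (Measure.pi fun _ : ι => gaussianReal 0 1) := i1.add i2
    rw [integral_add i12 (i3.const_mul 2), integral_add i1 i2, integral_const_mul, h3,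
      Finset.card_insert_of_notMem hi]
    push_cast
    linarith

/-- Variance bound for Lipschitz functions of independent Gaussians. -/
lemma L1Lipschitz.integral_sub_sq_le {c : ℝ} (hc : 0 ≤ c) {f : (ι → ℝ) → ℝ}
    (hf : L1Lipschitz c f) :
    ∫ g, (f g - ∫ g', f g' ∂(Measure.pi fun _ : ι => gaussianReal 0 1)) ^ 2
      ∂(Measure.pi fun _ : ι => gaussianReal 0 1) ≤ c ^ 2 * Fintype.card ι :=
  integral_sub_sq_le_of_dependsOn hc Finset.univ f hf fun i hi => absurd (Finset.mem_univ i) hi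

/-- The L² bound controls the L¹ norm because the variance of |f - m| is nonnegative. -/
lemma L1Lipschitz.integral_abs_sub_le {c : ℝ} (hc : 0 ≤ c) {f : (ι → ℝ) → ℝ}
    (hf : L1Lipschitz c f) :
    ∫ g, |f g - ∫ g', f g' ∂(Measure.pi fun _ : ι => gaussianReal 0 1)|
      ∂(Measure.pi fun _ : ι => gaussianReal 0 1) ≤ c * Real.sqrt (Fintype.card ι) := by
  set m := ∫ g', f g' ∂(Measure.pi fun _ : ι => gaussianReal 0 1)
  have h1 := hf.integral_sub_sq_le hc
  have hL : MemLp (fun g => |f g - m|) 2 (Measure.pi fun _ : ι => gaussianReal 0 1) :=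
    (hf.memLp.sub (memLp_const m)).abs
  have h2 := variance_nonneg (fun g => |f g - m|) (Measure.pi fun _ : ι => gaussianReal 0 1)
  rw [variance_eq_sub hL] at h2
  simp only [Pi.pow_apply, sq_abs] at h2
  have h3 : c * Real.sqrt (Fintype.card ι) = Real.sqrt (c ^ 2 * Fintype.card ι) := by
    rw [Real.sqrt_mul (sq_nonneg c), Real.sqrt_sq hc]
  rw [h3]
  refine Real.le_sqrt_of_sq_le ?_
  linarith

end Variance

/-! ### Countability of the kinks of a convex function -/

section Convex

/-- The right derivative is monotone, so it is continuous off a countable set; where it is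
continuous, the two one-sided derivatives agree. -/
lemma _root_.ConvexOn.countable_not_differentiableAt {f : ℝ → ℝ} (hf : ConvexOn ℝ Set.univ f) :
    {x | ¬ DifferentiableAt ℝ f x}.Countable := by
  have hmono : Monotone fun x => derivWithin f (Set.Ioi x) x := by
    have := hf.monotoneOn_rightDeriv
    rwa [interior_univ, monotoneOn_univ] at this
  refine hmono.countable_not_continuousAt.mono ?_
  intro x hx hcont
  refine hx ?_
  have hxi : x ∈ interior (Set.univ : Set ℝ) := by simp
  have hR := hf.hasDerivWithinAt_rightDeriv_of_mem_interior hxi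
  have hL := hf.hasDerivWithinAt_leftDeriv_of_mem_interior hxi
  have h1 := hf.leftDeriv_le_rightDeriv_of_mem_interior hxi
  -- For y < x, the right derivative at y is at most the slope from y to x, hence at most the left
  -- derivative at x; let y increase to x.
  have h2 : derivWithin f (Set.Ioi x) x ≤ derivWithin f (Set.Iio x) x := by
    have ht : Tendsto (fun y => derivWithin f (Set.Ioi y) y) (𝓝[<] x)
        (𝓝 (derivWithin f (Set.Ioi x) x)) := hcont.tendsto.mono_left nhdsWithin_le_nhds
    refine le_of_tendsto ht ?_
    filter_upwards [self_mem_nhdsWithin] with y hy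
    exact (hf.rightDeriv_le_slope_of_mem_interior (by simp) (Set.mem_univ x) hy).trans
      (hf.slope_le_leftDeriv_of_mem_interior (Set.mem_univ y) hxi hy)
  rw [le_antisymm h1 h2] at hL
  have h3 := (hasDerivWithinAt_Iio_iff_Iic.1 hL).union (hasDerivWithinAt_Ioi_iff_Ici.1 hR)
  rw [Set.Iic_union_Ici, hasDerivWithinAt_univ] at h3
  exact h3.differentiableAt

end Convex

/-! ### Marginals of product measures -/

section Reindex

variable {ι κ : Type*} [Fintype ι] [Fintype κ]

/-- Restricting independent variables along an injection gives independent variables. -/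
lemma measurePreserving_comp_of_injective (μ : Measure ℝ) [IsProbabilityMeasure μ] {φ : κ → ι}
    (hφ : Function.Injective φ) :
    MeasurePreserving (fun g : ι → ℝ => g ∘ φ) (Measure.pi fun _ : ι => μ)
      (Measure.pi fun _ : κ => μ) := by
  classical
  have hm : Measurable (fun g : ι → ℝ => g ∘ φ) :=
    measurable_pi_lambda _ fun k => measurable_pi_apply (φ k)
  refine ⟨hm, ?_⟩
  symm
  refine Measure.pi_eq fun s hs => ?_
  rw [Measure.map_apply hm (MeasurableSet.univ_pi hs)]
  set T : ι → Set ℝ := Function.extend φ s fun _ => Set.univ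
  have : (fun g : ι → ℝ => g ∘ φ) ⁻¹' (Set.univ.pi s) = Set.univ.pi T := by
    ext g
    simp only [Set.mem_preimage, Set.mem_pi, Set.mem_univ, true_imp_iff, Function.comp]
    constructor
    · intro h i
      by_cases hi : ∃ k, φ k = i
      · obtain ⟨k, rfl⟩ := hi
        simpa [T, hφ.extend_apply] using h k
      · simp [T, Function.extend_apply' _ _ _ hi]
    · intro h k
      simpa [T, hφ.extend_apply] using h (φ k)
  rw [this, Measure.pi_pi]
  have h1 : ∀ k, μ (s k) = μ (T (φ k)) := fun k => by simp [T, hφ.extend_apply]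
  simp_rw [h1]
  refine (Fintype.prod_of_injective φ hφ _ (fun i => μ (T i)) ?_ fun _ => rfl).symm
  intro i hi
  simp [T, Function.extend_apply' _ _ _ hi]

end Reindex

/-! ### Gibbs averages, the FKG inequality and the free energy -/

section Gibbs

variable {d n : ℕ}

lemma spin_eq_one_or (σ : Config d n) (x : box d n) : spin σ x = 1 ∨ spin σ x = -1 := by
  rcases Int.units_eq_one_or (σ x) with h | h <;> simp [spin, h]

lemma spin_mul_self (σ : Config d n) (x : box d n) : spin σ x * spin σ x = 1 := by
  rcases spin_eq_one_or σ x with h | h <;> simp [h]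

lemma abs_spin (σ : Config d n) (x : box d n) : |spin σ x| = 1 := by
  rcases spin_eq_one_or σ x with h | h <;> simp [h]

lemma partitionFn_pos (β h : ℝ) (g : box d n → ℝ) : 0 < partitionFn β h g :=
  sum_exp_pos _

lemma gibbs_pos (β h : ℝ) (g : box d n → ℝ) (σ : Config d n) : 0 < gibbs β h g σ :=
  div_pos (Real.exp_pos _) (partitionFn_pos _ _ _)

lemma sum_gibbs (β h : ℝ) (g : box d n → ℝ) : ∑ σ, gibbs β h g σ = 1 := by
  simp_rw [gibbs]
  rw [← Finset.sum_div]
  exact div_self (partitionFn_pos β h g).ne'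

lemma continuous_energy (β h : ℝ) (σ : Config d n) : Continuous fun g => energy β h g σ := by
  unfold energy; fun_prop

lemma continuous_gibbs (β h : ℝ) (σ : Config d n) : Continuous fun g => gibbs β h g σ := by
  unfold gibbs
  refine Continuous.div (Real.continuous_exp.comp (continuous_energy β h σ)) ?_
    fun g => (partitionFn_pos β h g).ne'
  exact continuous_finsetSum _ fun τ _ => Real.continuous_exp.comp (continuous_energy β h τ)

/-- The average `⟨f(σ)⟩` over one replica. -/
noncomputable def gibbsAvg (β h : ℝ) (g : box d n → ℝ) (f : Config d n → ℝ) : ℝ :=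
  ∑ σ, f σ * gibbs β h g σ

/-- The local magnetization `⟨σ_x⟩`. -/
noncomputable def mag (β h : ℝ) (g : box d n → ℝ) (x : box d n) : ℝ :=
  gibbsAvg β h g fun σ => spin σ x

/-- The truncated correlation `⟨σ_x σ_y⟩ - ⟨σ_x⟩⟨σ_y⟩`. -/
noncomputable def trunc (β h : ℝ) (g : box d n → ℝ) (x y : box d n) : ℝ :=
  gibbsAvg β h g (fun σ => spin σ x * spin σ y) - mag β h g x * mag β h g y

lemma continuous_gibbsAvg (β h : ℝ) (f : Config d n → ℝ) :
    Continuous fun g => gibbsAvg β h g f :=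
  continuous_finsetSum _ fun σ _ => continuous_const.mul (continuous_gibbs β h σ)

lemma continuous_mag (β h : ℝ) (x : box d n) : Continuous fun g => mag β h g x :=
  continuous_gibbsAvg _ _ _

lemma continuous_trunc (β h : ℝ) (x y : box d n) : Continuous fun g => trunc β h g x y :=
  (continuous_gibbsAvg _ _ _).sub ((continuous_mag _ _ _).mul (continuous_mag _ _ _))

lemma gibbsAvg_const (β h : ℝ) (g : box d n → ℝ) (c : ℝ) : gibbsAvg β h g (fun _ => c) = c := by
  rw [gibbsAvg, ← Finset.mul_sum, sum_gibbs, mul_one]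

lemma abs_gibbsAvg_le (β h : ℝ) (g : box d n → ℝ) {f : Config d n → ℝ} {C : ℝ}
    (hf : ∀ σ, |f σ| ≤ C) : |gibbsAvg β h g f| ≤ C := by
  rw [gibbsAvg]
  refine (Finset.abs_sum_le_sum_abs _ _).trans ?_
  calc ∑ σ, |f σ * gibbs β h g σ| ≤ ∑ σ, C * gibbs β h g σ := by
        refine Finset.sum_le_sum fun σ _ => ?_
        rw [abs_mul, abs_of_pos (gibbs_pos β h g σ)]
        exact mul_le_mul_of_nonneg_right (hf σ) (gibbs_pos β h g σ).le
    _ = C := by rw [← Finset.mul_sum, sum_gibbs, mul_one]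

lemma abs_mag_le (β h : ℝ) (g : box d n → ℝ) (x : box d n) : |mag β h g x| ≤ 1 :=
  abs_gibbsAvg_le β h g fun σ => (abs_spin σ x).le

lemma mag_sq_le (β h : ℝ) (g : box d n → ℝ) (x : box d n) : mag β h g x ^ 2 ≤ 1 := by
  rw [← sq_abs]
  exact pow_le_one₀ (abs_nonneg _) (abs_mag_le β h g x)

lemma abs_gibbsAvg_spin_mul_le (β h : ℝ) (g : box d n → ℝ) (x y : box d n) :
    |gibbsAvg β h g fun σ => spin σ x * spin σ y| ≤ 1 :=
  abs_gibbsAvg_le β h g fun σ => by rw [abs_mul, abs_spin, abs_spin, one_mul]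

lemma abs_mag_mul_mag_le (β h : ℝ) (g : box d n → ℝ) (x y : box d n) :
    |mag β h g x * mag β h g y| ≤ 1 := by
  rw [abs_mul]
  exact mul_le_one₀ (abs_mag_le β h g x) (abs_nonneg _) (abs_mag_le β h g y)

lemma abs_trunc_le (β h : ℝ) (g : box d n → ℝ) (x y : box d n) : |trunc β h g x y| ≤ 2 := by
  have h1 := abs_gibbsAvg_spin_mul_le β h g x y
  have h2 := abs_mag_mul_mag_le β h g x y
  rw [trunc]
  exact (abs_sub _ _).trans (by linarith)

lemma trunc_self (β h : ℝ) (g : box d n → ℝ) (x : box d n) :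
    trunc β h g x x = 1 - mag β h g x ^ 2 := by
  rw [trunc]
  simp_rw [spin_mul_self]
  rw [gibbsAvg_const, pow_two]

/-- Derivative of a Gibbs average with respect to the disorder at one site. -/
lemma hasDerivAt_gibbsAvg_update (β h : ℝ) (f : Config d n → ℝ) (g : box d n → ℝ)
    (y : box d n) (t : ℝ) :
    HasDerivAt (fun t => gibbsAvg β h (Function.update g y t) f)
      (h * (gibbsAvg β h (Function.update g y t) (fun σ => f σ * spin σ y) -
        gibbsAvg β h (Function.update g y t) f * mag β h (Function.update g y t) y)) t := by
  -- The energy is affine in the disorder at y, with slope h σ_y; the base point has zero disorder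
  -- there.
  have e : ∀ t σ, energy β h (Function.update g y t) σ =
      energy β h (Function.update g y 0) σ + t * (h * spin σ y) := by
    intro t σ
    have h1 : ∀ u, ∑ x, Function.update g y u x * spin σ x =
        u * spin σ y + ∑ x ∈ Finset.univ.erase y, g x * spin σ x := by
      intro u
      rw [← Finset.add_sum_erase _ _ (Finset.mem_univ y), Function.update_self]
      congr 1
      exact Finset.sum_congr rfl fun x hx => by
        rw [Function.update_of_ne (Finset.ne_of_mem_erase hx)]
    rw [energy, energy, h1, h1]
    ring
  have key := hasDerivAt_gibbs_average f (fun σ => energy β h (Function.update g y 0) σ)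
    (fun σ => h * spin σ y) t
  simp_rw [← e] at key
  refine key.congr_deriv ?_
  simp only [gibbsAvg, mag, gibbs, partitionFn]
  rw [mul_sub, mul_left_comm h]
  congr 1
  · rw [Finset.mul_sum]
    exact Finset.sum_congr rfl fun σ _ => by ring
  · congr 1
    rw [Finset.mul_sum]
    exact Finset.sum_congr rfl fun σ _ => by ring

lemma hasDerivAt_mag_update (β h : ℝ) (g : box d n → ℝ) (x y : box d n) (t : ℝ) :
    HasDerivAt (fun t => mag β h (Function.update g y t) x)
      (h * trunc β h (Function.update g y t) x y) t :=
  hasDerivAt_gibbsAvg_update β h (fun σ => spin σ x) g y t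

/-! ### The FKG inequality -/

lemma spin_mono {σ τ : Config d n} (hστ : σ ≤ τ) (x : box d n) : spin σ x ≤ spin τ x := by
  have : (σ x : ℤ) ≤ (τ x : ℤ) := Units.val_le_val.2 (hστ x)
  exact Int.cast_le.2 this

/-- Supermodularity of one bond. Summed over bonds it yields the FKG lattice condition. -/
lemma units_mul_add_mul_le : ∀ a b a' b' : ℤˣ, (a : ℤ) * b + a' * b' ≤
    ((a ⊓ a' : ℤˣ) : ℤ) * (b ⊓ b' : ℤˣ) + ((a ⊔ a' : ℤˣ) : ℤ) * (b ⊔ b' : ℤˣ) := by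
  decide

lemma units_add_eq : ∀ a a' : ℤˣ, ((a ⊓ a' : ℤˣ) : ℤ) + ((a ⊔ a' : ℤˣ) : ℤ) = a + a' := by
  decide

lemma bond_add_le (σ τ : Config d n) (e : Sym2 (box d n)) :
    bond σ e + bond τ e ≤ bond (σ ⊓ τ) e + bond (σ ⊔ τ) e := by
  induction e using Sym2.ind with
  | _ x y =>
    have := units_mul_add_mul_le (σ x) (σ y) (τ x) (τ y)
    simp only [bond, Sym2.lift_mk, spin, Pi.inf_apply, Pi.sup_apply]
    exact_mod_cast this

lemma spin_inf_add_spin_sup (σ τ : Config d n) (x : box d n) :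
    spin (σ ⊓ τ) x + spin (σ ⊔ τ) x = spin σ x + spin τ x := by
  have := units_add_eq (σ x) (τ x)
  simp only [spin, Pi.inf_apply, Pi.sup_apply]
  exact_mod_cast this

/-- The bond term is supermodular and the field term exactly modular, so the signs of h and g play
no role. -/
lemma energy_add_le {β : ℝ} (hβ : 0 ≤ β) (h : ℝ) (g : box d n → ℝ) (σ τ : Config d n) :
    energy β h g σ + energy β h g τ ≤ energy β h g (σ ⊓ τ) + energy β h g (σ ⊔ τ) := by
  have h1 : ∑ e ∈ (boxGraph d n).edgeFinset, bond σ e + ∑ e ∈ (boxGraph d n).edgeFinset, bond τ e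
      ≤ ∑ e ∈ (boxGraph d n).edgeFinset, bond (σ ⊓ τ) e +
        ∑ e ∈ (boxGraph d n).edgeFinset, bond (σ ⊔ τ) e := by
    rw [← Finset.sum_add_distrib, ← Finset.sum_add_distrib]
    exact Finset.sum_le_sum fun e _ => bond_add_le σ τ e
  have h2 : ∑ x, g x * spin (σ ⊓ τ) x + ∑ x, g x * spin (σ ⊔ τ) x =
      ∑ x, g x * spin σ x + ∑ x, g x * spin τ x := by
    rw [← Finset.sum_add_distrib, ← Finset.sum_add_distrib]
    refine Finset.sum_congr rfl fun x _ => ?_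
    rw [← mul_add, ← mul_add, spin_inf_add_spin_sup]
  simp only [energy]
  have h3 := mul_le_mul_of_nonneg_left h1 hβ
  have h4 := congrArg (h * ·) h2
  simp only [mul_add] at h3 h4
  linarith

/-- Truncated correlations of the ferromagnet are nonnegative. -/
lemma trunc_nonneg {β : ℝ} (hβ : 0 ≤ β) (h : ℝ) (g : box d n → ℝ) (x y : box d n) :
    0 ≤ trunc β h g x y := by
  have hpos : ∀ (z : box d n) (σ : Config d n), 0 ≤ spin σ z + 1 := fun z σ => by
    rcases spin_eq_one_or σ z with h | h <;> rw [h] <;> norm_num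
  -- `fkg` asks for nonnegative functions; adding 1 to each spin leaves the covariance unchanged.
  have key := fkg (μ := fun σ : Config d n => gibbs β h g σ) (f := fun σ => spin σ x + 1)
    (g := fun σ => spin σ y + 1) (fun σ => (gibbs_pos β h g σ).le) (hpos x) (hpos y)
    (fun σ τ hst => by simpa using spin_mono hst x) (fun σ τ hst => by simpa using spin_mono hst y)
    (fun σ τ => by
      simp only [gibbs]
      rw [div_mul_div_comm, div_mul_div_comm, ← Real.exp_add, ← Real.exp_add]
      have := partitionFn_pos β h g
      refine div_le_div_of_nonneg_right ?_ (by positivity)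
      exact Real.exp_le_exp.2 (energy_add_le hβ h g σ τ))
  rw [sum_gibbs, one_mul] at key
  have e1 : ∀ z, ∑ σ, gibbs β h g σ * (spin σ z + 1) = mag β h g z + 1 := by
    intro z
    simp_rw [mul_add, mul_one]
    rw [Finset.sum_add_distrib, sum_gibbs, mag, gibbsAvg]
    simp_rw [mul_comm]
  have e2 : ∑ σ, gibbs β h g σ * ((spin σ x + 1) * (spin σ y + 1)) =
      gibbsAvg β h g (fun σ => spin σ x * spin σ y) + mag β h g x + mag β h g y + 1 := by
    have e3 : ∀ σ, gibbs β h g σ * ((spin σ x + 1) * (spin σ y + 1)) =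
        spin σ x * spin σ y * gibbs β h g σ + spin σ x * gibbs β h g σ +
          spin σ y * gibbs β h g σ + gibbs β h g σ := fun σ => by ring
    simp_rw [e3, Finset.sum_add_distrib, sum_gibbs]
    rfl
  rw [e1, e1, e2] at key
  rw [trunc]
  nlinarith

/-! ### The free energy -/

/-- The free energy per site for a given disorder. -/
noncomputable def freeEnergy (β h : ℝ) (g : box d n → ℝ) : ℝ :=
  Real.log (partitionFn β h g) / ((box d n).card : ℝ)

/-- The derivative of the free energy in `h`. -/
noncomputable def fieldEnergy (β h : ℝ) (g : box d n → ℝ) : ℝ :=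
  (∑ x, g x * mag β h g x) / ((box d n).card : ℝ)

/-- The mean overlap `⟨R_{1,2}⟩`. -/
noncomputable def meanOverlap (β h : ℝ) (g : box d n → ℝ) : ℝ :=
  (∑ x, mag β h g x ^ 2) / ((box d n).card : ℝ)

lemma abs_log_partitionFn_sub_le (β h : ℝ) (g g' : box d n → ℝ) :
    |Real.log (partitionFn β h g) - Real.log (partitionFn β h g')| ≤
      |h| * ∑ x, |g x - g' x| := by
  refine abs_log_sum_exp_sub_le _ _ fun σ => ?_
  have e : energy β h g σ - energy β h g' σ = h * ∑ x, (g x - g' x) * spin σ x := by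
    simp only [energy, sub_mul, Finset.sum_sub_distrib]; ring
  rw [e, abs_mul]
  refine mul_le_mul_of_nonneg_left ((Finset.abs_sum_le_sum_abs _ _).trans_eq ?_) (abs_nonneg h)
  exact Finset.sum_congr rfl fun x _ => by rw [abs_mul, abs_spin, mul_one]

lemma l1Lipschitz_freeEnergy (β h : ℝ) :
    L1Lipschitz (|h| / ((box d n).card : ℝ)) (freeEnergy (d := d) (n := n) β h) := by
  intro g g'
  rw [freeEnergy, freeEnergy, ← sub_div, abs_div, Nat.abs_cast, div_mul_eq_mul_div]
  gcongr
  exact abs_log_partitionFn_sub_le β h g g'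

lemma l1Lipschitz_log_partitionFn (β h : ℝ) :
    L1Lipschitz |h| (fun g : box d n → ℝ => Real.log (partitionFn β h g)) :=
  abs_log_partitionFn_sub_le β h

lemma integrable_log_partitionFn (β h : ℝ) :
    Integrable (fun g => Real.log (partitionFn β h g)) (disorder d n) :=
  (l1Lipschitz_log_partitionFn β h).memLp.integrable one_le_two

lemma integrable_freeEnergy (β h : ℝ) : Integrable (freeEnergy β h) (disorder d n) :=
  (l1Lipschitz_freeEnergy β h).memLp.integrable one_le_two

/-- The energy is linear in (β,h). Joint convexity, not only convexity in h, is what later gives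
continuity of the limit. -/
lemma convexOn_meanFreeEnergy (d n : ℕ) :
    ConvexOn ℝ Set.univ fun z : ℝ × ℝ => meanFreeEnergy d n z.1 z.2 := by
  refine ⟨convex_univ, fun z _ w _ s t hs ht hst => ?_⟩
  have key : ∀ g, freeEnergy (d := d) (n := n) (s • z + t • w).1 (s • z + t • w).2 g ≤
      s * freeEnergy z.1 z.2 g + t * freeEnergy w.1 w.2 g := by
    intro g
    have e : ∀ σ : Config d n, energy (s • z + t • w).1 (s • z + t • w).2 g σ =
        s * energy z.1 z.2 g σ + t * energy w.1 w.2 g σ := fun σ => by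
      simp only [energy, Prod.fst_add, Prod.snd_add, Prod.smul_fst, Prod.smul_snd, smul_eq_mul]
      ring
    simp only [freeEnergy]
    rw [← mul_div_assoc, ← mul_div_assoc, ← add_div]
    gcongr
    have := log_sum_exp_convex (fun σ => energy z.1 z.2 g σ) (fun σ => energy w.1 w.2 g σ) hs ht hst
    simp_rw [← e] at this
    exact this
  have i1 := integrable_freeEnergy (d := d) (n := n)
  have h1 := integral_mono (i1 _ _)
    (((i1 z.1 z.2).const_mul s).add ((i1 w.1 w.2).const_mul t)) key
  simp only [Pi.add_apply] at h1
  rw [integral_add ((i1 z.1 z.2).const_mul s) ((i1 w.1 w.2).const_mul t), integral_const_mul,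
    integral_const_mul] at h1
  exact h1

instance (d n : ℕ) : IsProbabilityMeasure (disorder d n) := by
  unfold disorder; infer_instance

/-- Each of the N coordinates has influence at most |h| / N, so the fluctuations are of order |h| /
√N. -/
lemma integral_abs_freeEnergy_sub_le (β h : ℝ) :
    ∫ g, |freeEnergy β h g - meanFreeEnergy d n β h| ∂(disorder d n) ≤
      |h| / ((box d n).card : ℝ) * Real.sqrt ((box d n).card : ℝ) := by
  have h1 := (l1Lipschitz_freeEnergy (d := d) (n := n) β h).integral_abs_sub_le (by positivity)
  rw [Fintype.card_coe] at h1
  exact h1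

/-- `fieldEnergy` is a subgradient of the free energy in `h`. -/
lemma mul_fieldEnergy_le (β h δ : ℝ) (g : box d n → ℝ) :
    δ * fieldEnergy β h g ≤ freeEnergy β (h + δ) g - freeEnergy β h g := by
  have key := gradient_le_log_sum_exp_sub (fun σ => energy β h g σ)
    (fun σ => energy β (h + δ) g σ)
  have e : ∑ σ, (energy β (h + δ) g σ - energy β h g σ) *
      (Real.exp (energy β h g σ) / ∑ τ, Real.exp (energy β h g τ)) =
      δ * ∑ x, g x * mag β h g x := by
    have e1 : ∀ σ, energy β (h + δ) g σ - energy β h g σ = δ * ∑ x, g x * spin σ x := fun σ => by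
      simp only [energy]; ring
    simp_rw [e1, mag, gibbsAvg, Finset.mul_sum, Finset.sum_mul]
    rw [Finset.sum_comm]
    exact Finset.sum_congr rfl fun x _ => Finset.sum_congr rfl fun σ _ => by
      rw [gibbs, partitionFn]; ring
  rw [e] at key
  rw [fieldEnergy, freeEnergy, freeEnergy, ← sub_div, ← mul_div_assoc]
  gcongr
  exact key

end Gibbs

/-! ### Concentration of the overlap -/

section Overlap

variable {d n : ℕ}

lemma integrable_disorder_of_bounded {f : (box d n → ℝ) → ℝ} (hf : Continuous f) {C : ℝ}
    (hC : ∀ g, |f g| ≤ C) : Integrable f (disorder d n) :=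
  Integrable.of_bound hf.aestronglyMeasurable C (ae_of_all _ fun g => by simpa using hC g)

lemma integrable_trunc (β h : ℝ) (x y : box d n) :
    Integrable (fun g => trunc β h g x y) (disorder d n) :=
  integrable_disorder_of_bounded (continuous_trunc β h x y) fun g => abs_trunc_le β h g x y

lemma integrable_disorder_eval_mul (x : box d n) {f : (box d n → ℝ) → ℝ} (hf : Continuous f)
    {C : ℝ} (hC : ∀ g, |f g| ≤ C) : Integrable (fun g => g x * f g) (disorder d n) :=
  (integrable_eval_gaussian x).mul_bdd (c := C) hf.aestronglyMeasurable
    (ae_of_all _ fun g => by simpa using hC g)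

lemma integral_eval_mul_mag (β h : ℝ) (x y : box d n) :
    ∫ g, g y * mag β h g x ∂(disorder d n) = h * ∫ g, trunc β h g x y ∂(disorder d n) := by
  rw [← integral_const_mul]
  refine integral_eval_mul_gaussian y (C := 1) (C' := |h| * 2) (continuous_mag β h x).measurable
    ((continuous_trunc β h x y).const_mul h).measurable
    (fun g t => hasDerivAt_mag_update β h g x y t) (fun g => abs_mag_le β h g x) fun g => ?_
  rw [abs_mul]
  exact mul_le_mul_of_nonneg_left (abs_trunc_le β h g x y) (abs_nonneg h)

lemma integral_abs_sum_disorder_le :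
    ∫ g, |∑ x, g x| ∂(disorder d n) ≤ Real.sqrt ((box d n).card : ℝ) := by
  have hL : L1Lipschitz 1 (fun g : box d n → ℝ => ∑ x, g x) := fun g g' => by
    rw [← Finset.sum_sub_distrib, one_mul]
    exact Finset.abs_sum_le_sum_abs _ _
  have h0 : ∫ g, ∑ x, g x ∂(Measure.pi fun _ : box d n => gaussianReal 0 1) = 0 := by
    rw [integral_finsetSum _ fun x _ => integrable_eval_gaussian x]
    refine Finset.sum_eq_zero fun x _ => ?_
    -- Integration by parts against the constant 1 says that g_x has mean zero.
    have := integral_eval_mul_gaussian x (f := fun _ : box d n → ℝ => 1) (f' := fun _ => 0)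
      (C := 1) (C' := 0) measurable_const measurable_const (fun g t => hasDerivAt_const _ _)
      (by simp) (by simp)
    simpa using this
  have h1 := hL.integral_abs_sub_le zero_le_one
  rw [h0, Fintype.card_coe, one_mul] at h1
  simp only [sub_zero] at h1
  exact h1

/-- The total truncated correlation is of order at most `|V|^{3/2}`. -/
lemma mul_sum_integral_trunc_le (β h : ℝ) :
    h * ∑ x, ∑ y, ∫ g, trunc β h g x y ∂(disorder d n) ≤
      ((box d n).card : ℝ) * Real.sqrt ((box d n).card : ℝ) := by
  have hI : ∀ x y, Integrable (fun g => g y * mag β h g x) (disorder d n) := fun x y =>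
    integrable_disorder_eval_mul y (continuous_mag β h x) fun g => abs_mag_le β h g x
  -- Integration by parts read backwards, summed over all pairs; the double sum then factorizes.
  have e : h * ∑ x, ∑ y, ∫ g, trunc β h g x y ∂(disorder d n) =
      ∫ g, (∑ y, g y) * ∑ x, mag β h g x ∂(disorder d n) := by
    rw [Finset.mul_sum]
    simp_rw [Finset.mul_sum, ← integral_eval_mul_mag]
    rw [← Finset.sum_congr rfl fun x _ => integral_finsetSum _ fun y _ => hI x y,
      ← integral_finsetSum _ fun x _ => integrable_finsetSum _ fun y _ => hI x y]
    simp_rw [Finset.sum_mul]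
  have hS : ∀ g : box d n → ℝ, |∑ x, mag β h g x| ≤ ((box d n).card : ℝ) := fun g => by
    refine (Finset.abs_sum_le_sum_abs _ _).trans ?_
    refine (Finset.sum_le_sum fun x _ => abs_mag_le β h g x).trans_eq ?_
    simp
  have hA : Integrable (fun g : box d n → ℝ => ∑ y, g y) (disorder d n) :=
    integrable_finsetSum _ fun x _ => integrable_eval_gaussian x
  rw [e]
  calc ∫ g, (∑ y, g y) * ∑ x, mag β h g x ∂(disorder d n)
      ≤ ∫ g, ((box d n).card : ℝ) * |∑ y, g y| ∂(disorder d n) := by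
        refine integral_mono ?_ (hA.abs.const_mul _) fun g => ?_
        · exact hA.mul_bdd (c := ((box d n).card : ℝ))
            (continuous_finsetSum _ fun x _ => continuous_mag β h x).aestronglyMeasurable
            (ae_of_all _ fun g => by simpa using hS g)
        · refine (le_abs_self _).trans ?_
          rw [abs_mul, mul_comm]
          exact mul_le_mul_of_nonneg_right (hS g) (abs_nonneg _)
    _ ≤ _ := by
        rw [integral_const_mul]
        exact mul_le_mul_of_nonneg_left integral_abs_sum_disorder_le (Nat.cast_nonneg _)

lemma continuous_meanOverlap (β h : ℝ) : Continuous (meanOverlap (d := d) (n := n) β h) :=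
  (continuous_finsetSum _ fun x _ => (continuous_mag β h x).pow 2).div_const _

lemma meanOverlap_nonneg (β h : ℝ) (g : box d n → ℝ) : 0 ≤ meanOverlap β h g :=
  div_nonneg (Finset.sum_nonneg fun _ _ => sq_nonneg _) (Nat.cast_nonneg _)

lemma meanOverlap_le_one (β h : ℝ) (g : box d n → ℝ) : meanOverlap β h g ≤ 1 := by
  refine div_le_one_of_le₀ ?_ (Nat.cast_nonneg _)
  refine (Finset.sum_le_sum fun x _ => mag_sq_le β h g x).trans_eq ?_
  simp

lemma abs_meanOverlap_le (β h : ℝ) (g : box d n → ℝ) : |meanOverlap β h g| ≤ 1 := by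
  rw [abs_of_nonneg (meanOverlap_nonneg β h g)]
  exact meanOverlap_le_one β h g

lemma integrable_meanOverlap (β h : ℝ) : Integrable (meanOverlap β h) (disorder d n) :=
  integrable_disorder_of_bounded (continuous_meanOverlap β h) (abs_meanOverlap_le β h)

lemma integrable_meanOverlap_sq (β h : ℝ) :
    Integrable (fun g => meanOverlap β h g ^ 2) (disorder d n) :=
  integrable_disorder_of_bounded (C := 1) ((continuous_meanOverlap β h).pow 2) fun g => by
    rw [abs_pow]; exact pow_le_one₀ (abs_nonneg _) (abs_meanOverlap_le β h g)

lemma integrable_fieldEnergy (β h : ℝ) : Integrable (fieldEnergy β h) (disorder d n) :=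
  (integrable_finsetSum _ fun x _ =>
    integrable_disorder_eval_mul x (continuous_mag β h x) fun g => abs_mag_le β h g x).div_const _

lemma sum_trunc_self_div (β h : ℝ) (g : box d n → ℝ) (hN : (box d n).Nonempty) :
    (∑ x, trunc β h g x x) / ((box d n).card : ℝ) = 1 - meanOverlap β h g := by
  have hN' : ((box d n).card : ℝ) ≠ 0 := by exact_mod_cast hN.card_pos.ne'
  simp_rw [trunc_self]
  rw [Finset.sum_sub_distrib, meanOverlap, sub_div]
  simp [hN']

/-- Integration by parts at each site produces only the diagonal truncated correlations 1 - m_x²;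
this ties the derivative of the free energy to the overlap. -/
lemma integral_fieldEnergy (β h : ℝ) (hN : (box d n).Nonempty) :
    ∫ g, fieldEnergy β h g ∂(disorder d n) =
      h * (1 - ∫ g, meanOverlap β h g ∂(disorder d n)) := by
  simp_rw [fieldEnergy]
  rw [integral_div, integral_finsetSum _ fun x _ =>
    integrable_disorder_eval_mul x (continuous_mag β h x) fun g => abs_mag_le β h g x]
  simp_rw [integral_eval_mul_mag]
  rw [← Finset.mul_sum, ← integral_finsetSum _ fun x _ => integrable_trunc β h x x, mul_div_assoc,
    ← integral_div]
  simp_rw [sum_trunc_self_div _ _ _ hN]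
  rw [integral_sub (integrable_const _) (integrable_meanOverlap β h)]
  simp

lemma hasDerivAt_meanOverlap_update (β h : ℝ) (g : box d n → ℝ) (x : box d n) (t : ℝ) :
    HasDerivAt (fun t => meanOverlap β h (Function.update g x t))
      ((∑ y, 2 * mag β h (Function.update g x t) y *
        (h * trunc β h (Function.update g x t) y x)) / ((box d n).card : ℝ)) t := by
  refine HasDerivAt.div_const (HasDerivAt.fun_sum fun y _ => ?_) _
  have := (hasDerivAt_mag_update β h g y x t).fun_pow 2
  simpa using this

/-- FKG removes the absolute values from the truncated correlations, so the bound is linear in them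
and `mul_sum_integral_trunc_le` applies. -/
lemma abs_overlap_derivative_le {β h : ℝ} (hβ : 0 ≤ β) (hh : 0 ≤ h) (g : box d n → ℝ)
    (x : box d n) :
    |(∑ y, 2 * mag β h g y * (h * trunc β h g y x)) / ((box d n).card : ℝ)| ≤
      2 * h * (∑ y, trunc β h g y x) / ((box d n).card : ℝ) := by
  rw [abs_div, Nat.abs_cast]
  gcongr
  refine (Finset.abs_sum_le_sum_abs _ _).trans ?_
  rw [Finset.mul_sum]
  refine Finset.sum_le_sum fun y _ => ?_
  have h1 := trunc_nonneg hβ h g y x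
  rw [abs_mul, abs_mul, abs_mul, abs_of_nonneg h1, abs_of_nonneg hh, abs_two]
  have := mul_le_mul_of_nonneg_right (abs_mag_le β h g y) (mul_nonneg hh h1)
  linarith

lemma sum_trunc_div_le (β h : ℝ) (g : box d n → ℝ) (x : box d n) :
    (∑ y, trunc β h g y x) / ((box d n).card : ℝ) ≤ 2 := by
  have : (∑ y, trunc β h g y x) ≤ 2 * ((box d n).card : ℝ) := by
    refine (Finset.sum_le_sum fun y _ => (le_abs_self _).trans (abs_trunc_le β h g y x)).trans_eq ?_
    simp [mul_comm]
  exact div_le_of_le_mul₀ (Nat.cast_nonneg _) zero_le_two this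

/-- Integration by parts for `E(⟨H⟩⟨R⟩)`, the remainder being controlled by FKG. -/
lemma abs_integral_fieldEnergy_mul_meanOverlap_sub_le {β h : ℝ} (hβ : 0 ≤ β) (hh : 0 < h)
    (hN : (box d n).Nonempty) :
    |∫ g, fieldEnergy β h g * meanOverlap β h g ∂(disorder d n) -
      h * ∫ g, (1 - meanOverlap β h g) * meanOverlap β h g ∂(disorder d n)| ≤
      2 * Real.sqrt ((box d n).card : ℝ) / ((box d n).card : ℝ) := by
  have hN' : (0 : ℝ) < ((box d n).card : ℝ) := by exact_mod_cast hN.card_pos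
  set N : ℝ := ((box d n).card : ℝ) with hNdef
  -- D g x is the derivative of `meanOverlap` in g_x.
  set D : (box d n → ℝ) → box d n → ℝ := fun g x =>
    (∑ y, 2 * mag β h g y * (h * trunc β h g y x)) / N with hD
  have hDc : ∀ x, Continuous fun g => D g x := fun x =>
    (continuous_finsetSum _ fun y _ => ((continuous_mag β h y).const_mul 2).mul
      ((continuous_trunc β h y x).const_mul h)).div_const _
  have hDb : ∀ g x, |D g x| ≤ 4 * h := fun g x => by
    refine (abs_overlap_derivative_le hβ hh.le g x).trans ?_
    rw [mul_div_assoc]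
    have := mul_le_mul_of_nonneg_left (sum_trunc_div_le β h g x) (by positivity : 0 ≤ 2 * h)
    linarith
  have hmDb : ∀ g x, |mag β h g x * D g x| ≤ 4 * h := fun g x => by
    rw [abs_mul]
    exact (mul_le_of_le_one_left (abs_nonneg _) (abs_mag_le β h g x)).trans (hDb g x)
  have hmQ : ∀ (g : box d n → ℝ) (x : box d n), |mag β h g x * meanOverlap β h g| ≤ 1 := fun g x => by
    rw [abs_mul]
    exact mul_le_one₀ (abs_mag_le β h g x) (abs_nonneg _) (abs_meanOverlap_le β h g)
  have htQ : ∀ (g : box d n → ℝ) (x : box d n), |h * trunc β h g x x * meanOverlap β h g| ≤ 2 * h := fun g x => by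
    rw [abs_mul, abs_mul, abs_of_pos hh]
    have := mul_le_mul (abs_trunc_le β h g x x) (abs_meanOverlap_le β h g) (abs_nonneg _)
      zero_le_two
    calc h * |trunc β h g x x| * |meanOverlap β h g|
        = h * (|trunc β h g x x| * |meanOverlap β h g|) := by ring
      _ ≤ h * (2 * 1) := mul_le_mul_of_nonneg_left this hh.le
      _ = 2 * h := by ring
  have i1 : ∀ x, Integrable (fun g => h * trunc β h g x x * meanOverlap β h g) (disorder d n) :=
    fun x => integrable_disorder_of_bounded (((continuous_trunc β h x x).const_mul h).mul
      (continuous_meanOverlap β h)) fun g => htQ g x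
  have i2 : ∀ x, Integrable (fun g => mag β h g x * D g x) (disorder d n) := fun x =>
    integrable_disorder_of_bounded ((continuous_mag β h x).mul (hDc x)) fun g => hmDb g x
  -- Product rule: differentiating m_x gives the main term, differentiating the overlap gives the
  -- remainder.
  have ibp : ∀ x, ∫ g, g x * (mag β h g x * meanOverlap β h g) ∂(disorder d n) =
      ∫ g, h * trunc β h g x x * meanOverlap β h g ∂(disorder d n) +
        ∫ g, mag β h g x * D g x ∂(disorder d n) := by
    intro x
    rw [← integral_add (i1 x) (i2 x)]
    refine integral_eval_mul_gaussian x (C := 1) (C' := 2 * h + 4 * h)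
      ((continuous_mag β h x).mul (continuous_meanOverlap β h)).measurable
      ((((continuous_trunc β h x x).const_mul h).mul (continuous_meanOverlap β h)).add
        ((continuous_mag β h x).mul (hDc x))).measurable
      (fun g t => (hasDerivAt_mag_update β h g x x t).mul
        (hasDerivAt_meanOverlap_update β h g x t)) (fun g => hmQ g x) fun g => ?_
    exact (abs_add_le _ _).trans (add_le_add (htQ g x) (hmDb g x))
  have e1 : ∫ g, fieldEnergy β h g * meanOverlap β h g ∂(disorder d n) =
      (∑ x, ∫ g, g x * (mag β h g x * meanOverlap β h g) ∂(disorder d n)) / N := by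
    have i3 : ∀ x, Integrable (fun g => g x * (mag β h g x * meanOverlap β h g))
        (disorder d n) := fun x => integrable_disorder_eval_mul x
      ((continuous_mag β h x).mul (continuous_meanOverlap β h)) fun g => hmQ g x
    rw [← integral_finsetSum _ fun x _ => i3 x, ← integral_div]
    congr 1
    ext g
    rw [fieldEnergy, div_mul_eq_mul_div, Finset.sum_mul]
    congr 1
    exact Finset.sum_congr rfl fun x _ => by ring
  have e2 : (∑ x, ∫ g, h * trunc β h g x x * meanOverlap β h g ∂(disorder d n)) / N =
      h * ∫ g, (1 - meanOverlap β h g) * meanOverlap β h g ∂(disorder d n) := by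
    rw [← integral_finsetSum _ fun x _ => i1 x, ← integral_div, ← integral_const_mul]
    congr 1
    ext g
    rw [← sum_trunc_self_div β h g hN, ← Finset.sum_mul, ← Finset.mul_sum]
    ring
  have e3 : |(∑ x, ∫ g, mag β h g x * D g x ∂(disorder d n)) / N| ≤
      (∑ x, 2 * h * (∑ y, ∫ g, trunc β h g y x ∂(disorder d n)) / N) / N := by
    rw [abs_div, abs_of_pos hN']
    gcongr
    refine (Finset.abs_sum_le_sum_abs _ _).trans (Finset.sum_le_sum fun x _ => ?_)
    rw [← integral_finsetSum _ fun y _ => integrable_trunc β h y x, ← integral_const_mul,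
      ← integral_div]
    refine (abs_integral_le_integral_abs).trans (integral_mono (i2 x).abs ?_ fun g => ?_)
    · exact ((integrable_finsetSum _ fun y _ => integrable_trunc β h y x).const_mul _).div_const _
    · simp only
      rw [abs_mul]
      exact (mul_le_of_le_one_left (abs_nonneg _) (abs_mag_le β h g x)).trans
        (abs_overlap_derivative_le hβ hh.le g x)
  have e4 : (∑ x, 2 * h * (∑ y, ∫ g, trunc β h g y x ∂(disorder d n)) / N) / N =
      2 * (h * ∑ x, ∑ y, ∫ g, trunc β h g x y ∂(disorder d n)) / (N * N) := by
    rw [← Finset.sum_div, ← Finset.mul_sum, Finset.sum_comm, div_div]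
    ring
  have e5 := mul_sum_integral_trunc_le (d := d) (n := n) β h
  rw [e1, Finset.sum_congr rfl fun x _ => ibp x, Finset.sum_add_distrib, add_div, e2,
    add_sub_cancel_left]
  refine e3.trans ?_
  rw [e4]
  calc 2 * (h * ∑ x, ∑ y, ∫ g, trunc β h g x y ∂(disorder d n)) / (N * N)
      ≤ 2 * (N * Real.sqrt N) / (N * N) := by gcongr
    _ = 2 * Real.sqrt N / N := by field_simp

/-! ### The two-replica average -/

lemma replicaAvg_mul (β h : ℝ) (g : box d n → ℝ) (f₁ f₂ : Config d n → ℝ) :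
    replicaAvg β h g (fun σ₁ σ₂ => f₁ σ₁ * f₂ σ₂) = gibbsAvg β h g f₁ * gibbsAvg β h g f₂ := by
  rw [replicaAvg, gibbsAvg, gibbsAvg, Finset.sum_mul_sum]
  exact Finset.sum_congr rfl fun σ₁ _ => Finset.sum_congr rfl fun σ₂ _ => by ring

lemma replicaAvg_add (β h : ℝ) (g : box d n → ℝ) (F G : Config d n → Config d n → ℝ) :
    replicaAvg β h g (fun σ₁ σ₂ => F σ₁ σ₂ + G σ₁ σ₂) =
      replicaAvg β h g F + replicaAvg β h g G := by
  simp only [replicaAvg, add_mul, Finset.sum_add_distrib]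

lemma replicaAvg_const_mul (β h : ℝ) (g : box d n → ℝ) (c : ℝ)
    (F : Config d n → Config d n → ℝ) :
    replicaAvg β h g (fun σ₁ σ₂ => c * F σ₁ σ₂) = c * replicaAvg β h g F := by
  simp only [replicaAvg, Finset.mul_sum, mul_assoc]

lemma replicaAvg_sum (β h : ℝ) (g : box d n → ℝ) {ι : Type*} (s : Finset ι)
    (F : ι → Config d n → Config d n → ℝ) :
    replicaAvg β h g (fun σ₁ σ₂ => ∑ i ∈ s, F i σ₁ σ₂) = ∑ i ∈ s, replicaAvg β h g (F i) := by
  classical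
  induction s using Finset.induction_on with
  | empty => simp [replicaAvg]
  | insert i s hi ih =>
    simp only [Finset.sum_insert hi]
    rw [replicaAvg_add, ih]

lemma replicaAvg_const (β h : ℝ) (g : box d n → ℝ) (c : ℝ) :
    replicaAvg β h g (fun _ _ => c) = c := by
  have := replicaAvg_mul β h g (fun _ => c) (fun _ => 1)
  simpa [gibbsAvg_const] using this

/-- Expanding the square, independence of the replicas turns each pair term into ⟨σ_xσ_y⟩². -/
lemma replicaAvg_overlap_sub_sq (β h q : ℝ) (g : box d n → ℝ) :
    replicaAvg β h g (fun σ₁ σ₂ => (overlap σ₁ σ₂ - q) ^ 2) =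
      (∑ x, ∑ y, gibbsAvg β h g (fun σ => spin σ x * spin σ y) ^ 2) /
        (((box d n).card : ℝ) * ((box d n).card : ℝ)) - 2 * q * meanOverlap β h g + q ^ 2 := by
  set N : ℝ := ((box d n).card : ℝ) with hNdef
  have e : ∀ σ₁ σ₂ : Config d n, (overlap σ₁ σ₂ - q) ^ 2 =
      ((N * N)⁻¹ * (∑ x, ∑ y, (spin σ₁ x * spin σ₁ y) * (spin σ₂ x * spin σ₂ y)) +
        (-(2 * q) * N⁻¹) * ∑ x, spin σ₁ x * spin σ₂ x) + q ^ 2 := by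
    intro σ₁ σ₂
    have e1 : ∑ x, ∑ y, (spin σ₁ x * spin σ₁ y) * (spin σ₂ x * spin σ₂ y) =
        (∑ x, spin σ₁ x * spin σ₂ x) * ∑ x, spin σ₁ x * spin σ₂ x := by
      rw [Finset.sum_mul_sum]
      exact Finset.sum_congr rfl fun x _ => Finset.sum_congr rfl fun y _ => by ring
    rw [e1, overlap, mul_inv]
    ring
  simp_rw [e]
  rw [replicaAvg_add, replicaAvg_add, replicaAvg_const_mul, replicaAvg_const_mul,
    replicaAvg_const, replicaAvg_sum, replicaAvg_sum]
  simp_rw [replicaAvg_sum]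
  simp_rw [fun x y : box d n => replicaAvg_mul β h g (fun σ => spin σ x * spin σ y)
    (fun σ => spin σ x * spin σ y), fun x : box d n => replicaAvg_mul β h g (fun σ => spin σ x)
    (fun σ => spin σ x), ← pow_two]
  rw [meanOverlap]
  simp only [mag]
  ring

/-- With u = ⟨σ_xσ_y⟩ and v = m_x m_y, u² - v² = (u - v)(u + v) ≤ 2(u - v), since u - v ≥ 0 by FKG
and u, v ≤ 1. -/
lemma replicaAvg_overlap_sub_sq_le {β : ℝ} (hβ : 0 ≤ β) (h q : ℝ) (g : box d n → ℝ) :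
    replicaAvg β h g (fun σ₁ σ₂ => (overlap σ₁ σ₂ - q) ^ 2) ≤
      (meanOverlap β h g - q) ^ 2 + 2 * (∑ x, ∑ y, trunc β h g x y) /
        (((box d n).card : ℝ) * ((box d n).card : ℝ)) := by
  rw [replicaAvg_overlap_sub_sq]
  set N : ℝ := ((box d n).card : ℝ) with hNdef
  have h1 : ∑ x, ∑ y, gibbsAvg β h g (fun σ => spin σ x * spin σ y) ^ 2 ≤
      ∑ x, ∑ y, (2 * trunc β h g x y + mag β h g x ^ 2 * mag β h g y ^ 2) := by
    refine Finset.sum_le_sum fun x _ => Finset.sum_le_sum fun y _ => ?_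
    have h2 := trunc_nonneg hβ h g x y
    have h3 := (abs_le.1 (abs_gibbsAvg_spin_mul_le β h g x y)).2
    have h4 := (abs_le.1 (abs_mag_mul_mag_le β h g x y)).2
    have h5 : gibbsAvg β h g (fun σ => spin σ x * spin σ y) =
      trunc β h g x y + mag β h g x * mag β h g y := by rw [trunc]; ring
    rw [h5] at h3 ⊢
    nlinarith [mul_nonneg h2 (sub_nonneg.2 h3), mul_nonneg h2 (sub_nonneg.2 h4)]
  have h6 : ∑ x, ∑ y, (2 * trunc β h g x y + mag β h g x ^ 2 * mag β h g y ^ 2) =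
      2 * (∑ x, ∑ y, trunc β h g x y) + (∑ x, mag β h g x ^ 2) * ∑ x, mag β h g x ^ 2 := by
    simp_rw [Finset.sum_add_distrib, Finset.sum_mul_sum, Finset.mul_sum]
  have h7 := div_le_div_of_nonneg_right (h1.trans_eq h6) (mul_self_nonneg N)
  have h8 : ((∑ x, mag β h g x ^ 2) * ∑ x, mag β h g x ^ 2) / (N * N) =
      meanOverlap β h g ^ 2 := by
    rw [meanOverlap, ← div_mul_div_comm, pow_two]
  rw [add_div, h8] at h7
  linarith [sq_nonneg q]

lemma replicaAvg_nonneg (β h : ℝ) (g : box d n → ℝ) {F : Config d n → Config d n → ℝ}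
    (hF : ∀ σ₁ σ₂, 0 ≤ F σ₁ σ₂) : 0 ≤ replicaAvg β h g F :=
  Finset.sum_nonneg fun σ₁ _ => Finset.sum_nonneg fun σ₂ _ =>
    mul_nonneg (hF σ₁ σ₂) (mul_nonneg (gibbs_pos β h g σ₁).le (gibbs_pos β h g σ₂).le)

lemma overlapDeviation_nonneg (β h q : ℝ) : 0 ≤ overlapDeviation d n β h q :=
  integral_nonneg fun g => replicaAvg_nonneg β h g fun _ _ => sq_nonneg _

lemma overlapDeviation_le {β h : ℝ} (hβ : 0 ≤ β) (hh : 0 < h) (q : ℝ) (hN : (box d n).Nonempty) :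
    overlapDeviation d n β h q ≤
      ∫ g, (meanOverlap β h g - q) ^ 2 ∂(disorder d n) +
        2 / h * (Real.sqrt ((box d n).card : ℝ) / ((box d n).card : ℝ)) := by
  have hN' : (0 : ℝ) < ((box d n).card : ℝ) := by exact_mod_cast hN.card_pos
  set N : ℝ := ((box d n).card : ℝ) with hNdef
  have i1 : Integrable (fun g => (meanOverlap β h g - q) ^ 2) (disorder d n) := by
    have : (fun g : box d n → ℝ => (meanOverlap β h g - q) ^ 2) =
        fun g => meanOverlap β h g ^ 2 - 2 * q * meanOverlap β h g + q ^ 2 := by ext g; ring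
    rw [this]
    exact ((integrable_meanOverlap_sq β h).sub ((integrable_meanOverlap β h).const_mul _)).add
      (integrable_const _)
  have i2 : Integrable (fun g => 2 * (∑ x, ∑ y, trunc β h g x y) / (N * N)) (disorder d n) :=
    ((integrable_finsetSum _ fun x _ => integrable_finsetSum _ fun y _ =>
      integrable_trunc β h x y).const_mul 2).div_const _
  have i0 : Integrable (fun g => replicaAvg β h g (fun σ₁ σ₂ => (overlap σ₁ σ₂ - q) ^ 2))
      (disorder d n) := by
    refine (i1.add i2).mono' (Continuous.aestronglyMeasurable ?_) (ae_of_all _ fun g => ?_)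
    · exact continuous_finsetSum _ fun σ₁ _ => continuous_finsetSum _ fun σ₂ _ =>
        continuous_const.mul ((continuous_gibbs β h σ₁).mul (continuous_gibbs β h σ₂))
    · rw [Real.norm_eq_abs, abs_of_nonneg (replicaAvg_nonneg β h g fun _ _ => sq_nonneg _)]
      exact replicaAvg_overlap_sub_sq_le hβ h q g
  have h1 := integral_mono i0 (i1.add i2) fun g => replicaAvg_overlap_sub_sq_le hβ h q g
  simp only [Pi.add_apply] at h1
  rw [integral_add i1 i2] at h1
  refine h1.trans (add_le_add_right ?_ _)
  rw [integral_div, integral_const_mul, integral_finsetSum _ fun x _ => integrable_finsetSum _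
    fun y _ => integrable_trunc β h x y, Finset.sum_congr rfl fun x _ => integral_finsetSum _
    fun y _ => integrable_trunc β h x y]
  have h2 := mul_sum_integral_trunc_le (d := d) (n := n) β h
  rw [mul_comm h, ← le_div_iff₀ hh] at h2
  calc 2 * (∑ x, ∑ y, ∫ g, trunc β h g x y ∂(disorder d n)) / (N * N)
      ≤ 2 * (N * Real.sqrt N / h) / (N * N) := by gcongr
    _ = _ := by field_simp

/-- The deviation of the overlap is controlled by the fluctuations of the field energy. -/
lemma overlapDeviation_le_of_fieldEnergy {β h : ℝ} (hβ : 0 ≤ β) (hh : 0 < h) (q : ℝ)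
    (hN : (box d n).Nonempty) :
    overlapDeviation d n β h q ≤
      (1 + |q|) / h * ∫ g, |fieldEnergy β h g - h * (1 - q)| ∂(disorder d n) +
        4 / h * (Real.sqrt ((box d n).card : ℝ) / ((box d n).card : ℝ)) := by
  have h1 := overlapDeviation_le hβ hh q hN
  have h2 := abs_integral_fieldEnergy_mul_meanOverlap_sub_le hβ hh hN
  have h3 := integral_fieldEnergy β h hN
  set r : ℝ := Real.sqrt ((box d n).card : ℝ) / ((box d n).card : ℝ) with hr
  set Δ := ∫ g, |fieldEnergy β h g - h * (1 - q)| ∂(disorder d n) with hΔ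
  have iM := integrable_fieldEnergy (d := d) (n := n) β h
  have iQ := integrable_meanOverlap (d := d) (n := n) β h
  have iQ2 := integrable_meanOverlap_sq (d := d) (n := n) β h
  have iD : Integrable (fun g => fieldEnergy β h g - h * (1 - q)) (disorder d n) :=
    iM.sub (integrable_const _)
  have iMQ : Integrable (fun g => fieldEnergy β h g * meanOverlap β h g) (disorder d n) :=
    iM.mul_bdd (c := 1) (continuous_meanOverlap β h).aestronglyMeasurable
      (ae_of_all _ fun g => by simpa using abs_meanOverlap_le β h g)
  set a := ∫ g, meanOverlap β h g ∂(disorder d n) with ha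
  set b := ∫ g, meanOverlap β h g ^ 2 ∂(disorder d n) with hb
  have e1 : ∫ g, (1 - meanOverlap β h g) * meanOverlap β h g ∂(disorder d n) = a - b := by
    rw [ha, hb, ← integral_sub iQ iQ2]
    congr 1; ext g; ring
  have e2 : ∫ g, (meanOverlap β h g - q) ^ 2 ∂(disorder d n) = b - 2 * q * a + q ^ 2 := by
    have e : ∀ g : box d n → ℝ, (meanOverlap β h g - q) ^ 2 =
        meanOverlap β h g ^ 2 - 2 * q * meanOverlap β h g + q ^ 2 := fun g => by ring
    simp_rw [e]
    have i3 : Integrable (fun g => meanOverlap β h g ^ 2 - 2 * q * meanOverlap β h g)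
      (disorder d n) := iQ2.sub (iQ.const_mul _)
    rw [integral_add i3 (integrable_const _), integral_sub iQ2 (iQ.const_mul _),
      integral_const_mul]
    simp [ha, hb]
  have d1 : h * |a - q| ≤ Δ := by
    have : ∫ g, (fieldEnergy β h g - h * (1 - q)) ∂(disorder d n) = -(h * (a - q)) := by
      rw [integral_sub iM (integrable_const _), h3]
      simp
      ring
    have h4 := abs_integral_le_integral_abs (f := fun g => fieldEnergy β h g - h * (1 - q))
      (μ := disorder d n)
    rwa [this, abs_neg, abs_mul, abs_of_pos hh] at h4
  -- First evaluation of E(MQ): M is replaced by the constant h(1 - q), at cost Δ because |Q| ≤ 1.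
  have d2 : |∫ g, fieldEnergy β h g * meanOverlap β h g ∂(disorder d n) - h * (1 - q) * a| ≤ Δ := by
    rw [ha, ← integral_const_mul, ← integral_sub iMQ (iQ.const_mul _)]
    refine abs_integral_le_integral_abs.trans
      (integral_mono (iMQ.sub (iQ.const_mul _)).abs iD.abs fun g => ?_)
    simp only
    rw [← sub_mul, abs_mul]
    exact mul_le_of_le_one_right (abs_nonneg _) (abs_meanOverlap_le β h g)
  rw [e1] at h2
  rw [e2] at h1
  rw [mul_div_assoc, ← hr] at h2
  -- Second evaluation: by parts, E(MQ) is h(a - b) up to 2r. The difference of the two is h(b -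
  -- qa).
  have d3 : h * (b - q * a) ≤ Δ + 2 * r := by
    have := (abs_le.1 h2).1
    have := (abs_le.1 h2).2
    have := (abs_le.1 d2).1
    have := (abs_le.1 d2).2
    linarith
  -- b - 2qa + q² = (b - qa) - q(a - q), bounded by `d3` and `d1`.
  have d4 : h * (b - 2 * q * a + q ^ 2) ≤ (1 + |q|) * Δ + 2 * r := by
    have h5 : -(q * (a - q)) ≤ |q| * |a - q| := by rw [← abs_mul]; exact neg_le_abs _
    have h6 := mul_le_mul_of_nonneg_left d1 (abs_nonneg q)
    have h7 := mul_le_mul_of_nonneg_left h5 hh.le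
    linarith
  rw [mul_comm h, ← le_div_iff₀ hh] at d4
  refine h1.trans ((add_le_add_left d4 _).trans_eq ?_)
  field_simp
  ring

/-- Identifies q as the limit of the mean overlaps, which confines it to their range. -/
lemma abs_integral_meanOverlap_sub_le {β h : ℝ} (hh : 0 < h) (q : ℝ) (hN : (box d n).Nonempty) :
    |∫ g, meanOverlap β h g ∂(disorder d n) - q| ≤
      h⁻¹ * ∫ g, |fieldEnergy β h g - h * (1 - q)| ∂(disorder d n) := by
  have h3 := integral_fieldEnergy β h hN
  have iM := integrable_fieldEnergy (d := d) (n := n) β h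
  have : ∫ g, (fieldEnergy β h g - h * (1 - q)) ∂(disorder d n) =
      -(h * (∫ g, meanOverlap β h g ∂(disorder d n) - q)) := by
    rw [integral_sub iM (integrable_const _), h3]
    simp
    ring
  have h4 := abs_integral_le_integral_abs (f := fun g => fieldEnergy β h g - h * (1 - q))
    (μ := disorder d n)
  rw [this, abs_neg, abs_mul, abs_of_pos hh] at h4
  rwa [inv_mul_eq_div, le_div_iff₀ hh, mul_comm]

end Overlap

/-! ### Existence of the thermodynamic limit by block decomposition -/

section Blocks

lemma card_box (d n : ℕ) : (box d n).card = n ^ d := by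
  simp [box, Fintype.card_piFinset]

lemma mem_box {d n : ℕ} {x : Fin d → ℤ} : x ∈ box d n ↔ ∀ i, 1 ≤ x i ∧ x i ≤ n := by
  simp [box, Fintype.mem_piFinset]

/-- A sum over ordered adjacent pairs counts every edge twice. -/
lemma sum_sum_adj_eq_two_mul_sum_edgeFinset {V : Type*} [Fintype V] [DecidableEq V]
    (G : SimpleGraph V) [DecidableRel G.Adj] (f : Sym2 V → ℝ) :
    ∑ x, ∑ y, (if G.Adj x y then f s(x, y) else 0) = 2 * ∑ e ∈ G.edgeFinset, f e := by
  have h1 : ∑ x, ∑ y, (if G.Adj x y then f s(x, y) else 0) = ∑ a : G.Dart, f a.edge := by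
    rw [← Fintype.sum_prod_type' (f := fun x y => if G.Adj x y then f s(x, y) else 0),
      ← Finset.sum_filter]
    refine Finset.sum_bij' (fun p hp => ⟨p, (Finset.mem_filter.1 hp).2⟩) (fun a _ => a.toProd)
      ?_ ?_ ?_ ?_ ?_
    · simp
    · intro a _; simp
    · simp
    · simp
    · intro p hp; rfl
  rw [h1, ← Finset.sum_fiberwise_of_maps_to (t := G.edgeFinset) (g := fun a : G.Dart => a.edge)
    (fun a _ => by simp), Finset.mul_sum]
  refine Finset.sum_congr rfl fun e he => ?_
  have h2 : ∑ a : G.Dart with a.edge = e, f a.edge = ∑ a : G.Dart with a.edge = e, f e :=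
    Finset.sum_congr rfl fun a ha => by rw [(Finset.mem_filter.1 ha).2]
  rw [h2, Finset.sum_const, G.dart_edge_fiber_card e (by simpa using he)]
  simp

/-- The interaction `∑ σ_x σ_y` over the bonds of the box. -/
noncomputable def interaction {d n : ℕ} (σ : Config d n) : ℝ :=
  ∑ e ∈ (boxGraph d n).edgeFinset, bond σ e

lemma two_mul_interaction {d n : ℕ} (σ : Config d n) :
    2 * interaction σ =
      ∑ x, ∑ y, (if (boxGraph d n).Adj x y then spin σ x * spin σ y else 0) := by
  rw [interaction, ← sum_sum_adj_eq_two_mul_sum_edgeFinset]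
  rfl

/-- An excess of one block costs m, which offsets between 1 and m cannot make up. -/
lemma blockIndex_le {m y y' z z' : ℤ} (hm : 0 ≤ m) (hz : 1 ≤ z) (hz' : z' ≤ m)
    (h : y * m + z ≤ y' * m + z') : y ≤ y' := by
  by_contra hlt
  have : (y' + 1) * m ≤ y * m := mul_le_mul_of_nonneg_right (by omega) hm
  linarith

variable {d k m : ℕ}

/-- The site with offset `z` in the block with index `y` of the box of side `k * m`. -/
def blockSite (p : (Fin d → Fin k) × box d m) : box d (k * m) :=
  -- Block indices start at 0 and offsets at 1, so coordinates stay in [1, k * m].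
  ⟨fun i => (p.1 i : ℕ) * (m : ℤ) + p.2.1 i, by
    rw [mem_box]
    intro i
    have hz := mem_box.1 p.2.2 i
    have h1 : (0 : ℤ) ≤ ((p.1 i : ℕ) : ℤ) * m := by positivity
    have h2 : (((p.1 i : ℕ) : ℤ) + 1) * m ≤ k * m :=
      mul_le_mul_of_nonneg_right (by have := (p.1 i).2; omega) (by positivity)
    push_cast
    constructor <;> linarith⟩

lemma blockSite_apply (p : (Fin d → Fin k) × box d m) (i : Fin d) :
    (blockSite p).1 i = (p.1 i : ℕ) * (m : ℤ) + p.2.1 i := rfl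

lemma blockIndex_eq_of_eq {p p' : (Fin d → Fin k) × box d m} {i : Fin d}
    (h : (blockSite p).1 i = (blockSite p').1 i) : p.1 i = p'.1 i := by
  rw [blockSite_apply, blockSite_apply] at h
  have hz := mem_box.1 p.2.2 i
  have hz' := mem_box.1 p'.2.2 i
  have h1 := blockIndex_le (by positivity) hz.1 hz'.2 h.le
  have h2 := blockIndex_le (by positivity) hz'.1 hz.2 h.ge
  exact Fin.ext (by omega)

lemma blockSite_injective : Function.Injective (blockSite (d := d) (k := k) (m := m)) := by
  intro p p' h
  have hc : ∀ i, (blockSite p).1 i = (blockSite p').1 i := fun i => by rw [h]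
  have h1 : p.1 = p'.1 := funext fun i => blockIndex_eq_of_eq (hc i)
  refine Prod.ext h1 (Subtype.ext (funext fun i => ?_))
  have := hc i
  rw [blockSite_apply, blockSite_apply, h1] at this
  linarith

lemma blockSite_bijective : Function.Bijective (blockSite (d := d) (k := k) (m := m)) := by
  rw [Fintype.bijective_iff_injective_and_card]
  refine ⟨blockSite_injective, ?_⟩
  rw [Fintype.card_prod, Fintype.card_coe, Fintype.card_coe, card_box, card_box]
  simp [mul_pow]

lemma adj_blockSite_iff (y : Fin d → Fin k) (z z' : box d m) :
    (boxGraph d (k * m)).Adj (blockSite (y, z)) (blockSite (y, z')) ↔ (boxGraph d m).Adj z z' := by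
  show ∑ i, |(blockSite (y, z)).1 i - (blockSite (y, z')).1 i| = 1 ↔ ∑ i, |z.1 i - z'.1 i| = 1
  simp only [blockSite_apply, add_sub_add_left_eq_sub]

lemma exists_of_sum_abs_eq_one {x x' : Fin d → ℤ} (h : ∑ i, |x i - x' i| = 1) :
    ∃ i, (x' i = x i + 1 ∨ x' i = x i - 1) ∧ ∀ j ≠ i, x' j = x j := by
  have h0 : ∃ i, x i ≠ x' i := by
    by_contra hall
    push Not at hall
    simp [hall] at h
  obtain ⟨i, hi⟩ := h0
  rw [← Finset.add_sum_erase _ _ (Finset.mem_univ i)] at h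
  have h1 : 1 ≤ |x i - x' i| := Int.one_le_abs (sub_ne_zero.2 hi)
  have h2 : 0 ≤ ∑ j ∈ Finset.univ.erase i, |x j - x' j| :=
    Finset.sum_nonneg fun _ _ => abs_nonneg _
  have h3 : ∑ j ∈ Finset.univ.erase i, |x j - x' j| = 0 := by omega
  have h4 : |x i - x' i| = 1 := by omega
  refine ⟨i, ?_, fun j hj => ?_⟩
  · rcases abs_eq (zero_le_one) |>.1 h4 with h5 | h5 <;> omega
  · have := (Finset.sum_eq_zero_iff_of_nonneg fun _ _ => abs_nonneg _).1 h3 j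
      (Finset.mem_erase.2 ⟨hj, Finset.mem_univ j⟩)
    rw [abs_eq_zero] at this
    omega

/-- Ordered pairs of neighbouring sites in different blocks. -/
noncomputable def crossing (d k m : ℕ) :
    Finset (((Fin d → Fin k) × box d m) × ((Fin d → Fin k) × box d m)) :=
  {q | q.1.1 ≠ q.2.1 ∧ (boxGraph d (k * m)).Adj (blockSite q.1) (blockSite q.2)}

/-- Pairs whose second site is the first one shifted by `s` in direction `i`, out of the face
with `i`-th offset `c`. -/
noncomputable def crossingDir (d k m : ℕ) (i : Fin d) (s c : ℤ) :
    Finset (((Fin d → Fin k) × box d m) × ((Fin d → Fin k) × box d m)) :=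
  {q | (∀ j, (blockSite q.2).1 j = (blockSite q.1).1 j + if j = i then s else 0) ∧
    q.1.2.1 i = c}

/-- A bond moves one coordinate by ±1. If it leaves the block, the first site has extreme offset in
that coordinate: m when stepping up, 1 when stepping down. -/
lemma crossing_subset : crossing d k m ⊆ Finset.univ.biUnion fun i =>
    crossingDir d k m i 1 m ∪ crossingDir d k m i (-1) 1 := by
  rintro ⟨p, p'⟩ hq
  obtain ⟨hne, hadj⟩ := (Finset.mem_filter.1 hq).2
  obtain ⟨i, hi, hj⟩ := exists_of_sum_abs_eq_one
    (show ∑ i, |(blockSite p).1 i - (blockSite p').1 i| = 1 from hadj)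
  have hnei : p.1 i ≠ p'.1 i := fun heq => hne <| funext fun j => by
    by_cases hji : j = i
    · rw [hji, heq]
    · exact blockIndex_eq_of_eq (hj j hji).symm
  have hz := mem_box.1 p.2.2 i
  have hz' := mem_box.1 p'.2.2 i
  rw [Finset.mem_biUnion]
  refine ⟨i, Finset.mem_univ i, ?_⟩
  rw [Finset.mem_union]
  have hneZ : ((p.1 i : ℕ) : ℤ) ≠ ((p'.1 i : ℕ) : ℤ) := fun h =>
    hnei (Fin.ext (by exact_mod_cast h))
  rcases hi with hi | hi
  · left
    refine Finset.mem_filter.2 ⟨Finset.mem_univ _, fun j => ?_, ?_⟩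
    · by_cases hji : j = i
      · subst hji; simp [hi]
      · simp [hji, hj j hji]
    · rw [blockSite_apply, blockSite_apply] at hi
      have h1 := blockIndex_le (m := m) (y := ((p.1 i : ℕ) : ℤ)) (y' := ((p'.1 i : ℕ) : ℤ))
        (by positivity) hz.1 hz'.2 (by linarith)
      have h2 : (((p.1 i : ℕ) : ℤ) + 1) * m ≤ ((p'.1 i : ℕ) : ℤ) * m :=
        mul_le_mul_of_nonneg_right (by omega) (by positivity)
      show p.2.1 i = m
      linarith
  · right
    refine Finset.mem_filter.2 ⟨Finset.mem_univ _, fun j => ?_, ?_⟩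
    · by_cases hji : j = i
      · subst hji; simp [hi]; ring
      · simp [hji, hj j hji]
    · rw [blockSite_apply, blockSite_apply] at hi
      have h1 := blockIndex_le (m := m) (y := ((p'.1 i : ℕ) : ℤ)) (y' := ((p.1 i : ℕ) : ℤ))
        (by positivity) hz'.1 hz.2 (by linarith)
      have h2 : (((p'.1 i : ℕ) : ℤ) + 1) * m ≤ ((p.1 i : ℕ) : ℤ) * m :=
        mul_le_mul_of_nonneg_right (by omega) (by positivity)
      show p.2.1 i = 1
      linarith

/-- The face has at most m^(d-1) sites; multiplying by m avoids the subtraction in the exponent. -/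
lemma card_face_mul_le (d m : ℕ) (i : Fin d) (c : ℤ) :
    (Finset.univ.filter fun z : box d m => z.1 i = c).card * m ≤ m ^ d := by
  set F : Fin d → Finset ℤ := Function.update (fun _ => Finset.Icc (1 : ℤ) m) i {c}
  have h1 : (Finset.univ.filter fun z : box d m => z.1 i = c).card ≤
      (Fintype.piFinset F).card := by
    refine Finset.card_le_card_of_injOn (fun z => z.1) (fun z hz => ?_)
      Subtype.val_injective.injOn
    have hz' : z.1 i = c := by simpa using hz
    rw [Finset.mem_coe, Fintype.mem_piFinset]
    intro j
    by_cases hj : j = i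
    · subst hj; simp [F, hz']
    · have := mem_box.1 z.2 j
      simpa [F, hj] using this
  refine (Nat.mul_le_mul_right m h1).trans_eq ?_
  rw [Fintype.card_piFinset, ← Finset.mul_prod_erase _ _ (Finset.mem_univ i)]
  have h2 : ∏ j ∈ Finset.univ.erase i, (F j).card = ∏ j ∈ Finset.univ.erase i, m :=
    Finset.prod_congr rfl fun j hj => by simp [F, Finset.ne_of_mem_erase hj]
  rw [h2]
  have h3 : m * ∏ j ∈ Finset.univ.erase i, m = m ^ d := by
    rw [Finset.mul_prod_erase Finset.univ (fun _ => m) (Finset.mem_univ i)]; simp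
  simp only [F, Function.update_self, Finset.card_singleton, one_mul]
  rw [mul_comm, h3]

/-- A pair is determined by its first site, which lies on a face of one of the k^d blocks. -/
lemma card_crossingDir_mul_le (i : Fin d) (s c : ℤ) :
    (crossingDir d k m i s c).card * m ≤ (k * m) ^ d := by
  have h1 : (crossingDir d k m i s c).card ≤ ((Finset.univ : Finset (Fin d → Fin k)) ×ˢ
      (Finset.univ.filter fun z : box d m => z.1 i = c)).card := by
    refine Finset.card_le_card_of_injOn Prod.fst (fun q hq => ?_) fun q hq q' hq' hqq => ?_
    · have := (Finset.mem_filter.1 hq).2.2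
      simpa using this
    · have h2 := (Finset.mem_filter.1 hq).2.1
      have h3 := (Finset.mem_filter.1 hq').2.1
      refine Prod.ext hqq (blockSite_injective (Subtype.ext (funext fun j => ?_)))
      rw [h2, h3, hqq]
  rw [Finset.card_product] at h1
  refine (Nat.mul_le_mul_right m h1).trans ?_
  rw [mul_assoc, mul_pow]
  refine Nat.mul_le_mul (by simp) (card_face_mul_le d m i c)

lemma card_crossing_mul_le : (crossing d k m).card * m ≤ 2 * d * (k * m) ^ d := by
  have h1 : (crossing d k m).card ≤ ∑ i : Fin d,
      ((crossingDir d k m i 1 m).card + (crossingDir d k m i (-1) 1).card) :=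
    (Finset.card_le_card crossing_subset).trans (Finset.card_biUnion_le.trans
      (Finset.sum_le_sum fun i _ => Finset.card_union_le _ _))
  refine (Nat.mul_le_mul_right m h1).trans ?_
  rw [Finset.sum_mul]
  refine (Finset.sum_le_sum (g := fun _ => 2 * (k * m) ^ d) fun i _ => ?_).trans_eq ?_
  · have h2 := card_crossingDir_mul_le (k := k) (m := m) i 1 m
    have h3 := card_crossingDir_mul_le (k := k) (m := m) i (-1) 1
    rw [add_mul]; omega
  · simp; ring

/-- The restriction of a function on the large box to the block with index `y`. -/
def restrictBlock {α : Type*} (σ : box d (k * m) → α) (y : Fin d → Fin k) (z : box d m) : α :=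
  σ (blockSite (y, z))

lemma abs_interaction_sub_le (σ : Config d (k * m)) (hm : 0 < m) :
    |interaction σ - ∑ y, interaction (d := d) (n := m) (restrictBlock σ y)| ≤
      d * ((k * m : ℕ) : ℝ) ^ d / m := by
  have e1 : 2 * interaction σ = ∑ p : (Fin d → Fin k) × box d m,
      ∑ p' : (Fin d → Fin k) × box d m,
      (if (boxGraph d (k * m)).Adj (blockSite p) (blockSite p') then
        spin σ (blockSite p) * spin σ (blockSite p') else 0) := by
    rw [two_mul_interaction]
    refine (Fintype.sum_bijective blockSite blockSite_bijective _ _ fun p => ?_).symm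
    exact Fintype.sum_bijective blockSite blockSite_bijective _ _ fun p' => rfl
  have e2 : 2 * ∑ y, interaction (d := d) (n := m) (restrictBlock σ y) =
      ∑ p : (Fin d → Fin k) × box d m, ∑ p' : (Fin d → Fin k) × box d m,
      (if p.1 = p'.1 then
        (if (boxGraph d (k * m)).Adj (blockSite p) (blockSite p') then
        spin σ (blockSite p) * spin σ (blockSite p') else 0) else 0) := by
    rw [Finset.mul_sum]
    simp_rw [two_mul_interaction, Fintype.sum_prod_type]
    refine Finset.sum_congr rfl fun y _ => Finset.sum_congr rfl fun z _ => ?_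
    rw [Finset.sum_eq_single y]
    · simp only [if_true]
      refine Finset.sum_congr rfl fun z' _ => ?_
      simp only [adj_blockSite_iff]
      rfl
    · intro y' _ hy'
      simp [hy'.symm]
    · simp
  -- Pairs inside a block cancel, and each crossing pair contributes at most 1. The left factor 2
  -- reflects ordered pairs and absorbs the 2 of `card_crossing_mul_le`.
  have e3 : 2 * |interaction σ - ∑ y, interaction (d := d) (n := m) (restrictBlock σ y)| ≤
      (crossing d k m).card := by
    have e4 : 2 * |interaction σ - ∑ y, interaction (d := d) (n := m) (restrictBlock σ y)| =
        |2 * interaction σ - 2 * ∑ y, interaction (d := d) (n := m) (restrictBlock σ y)| := by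
      rw [← mul_sub, abs_mul, abs_two]
    rw [e4, e1, e2, ← Finset.sum_sub_distrib]
    simp_rw [← Finset.sum_sub_distrib]
    rw [← Fintype.sum_prod_type' (f := fun p p' : (Fin d → Fin k) × box d m =>
      ((if (boxGraph d (k * m)).Adj (blockSite p) (blockSite p') then
        spin σ (blockSite p) * spin σ (blockSite p') else 0) - if p.1 = p'.1 then
        (if (boxGraph d (k * m)).Adj (blockSite p) (blockSite p') then
        spin σ (blockSite p) * spin σ (blockSite p') else 0) else 0))]
    refine (Finset.abs_sum_le_sum_abs _ _).trans ?_
    rw [crossing, Finset.card_filter]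
    push_cast
    refine Finset.sum_le_sum fun q _ => ?_
    by_cases h1 : q.1.1 = q.2.1
    · simp [h1]
    · by_cases h2 : (boxGraph d (k * m)).Adj (blockSite q.1) (blockSite q.2)
      · simp [h1, h2, abs_mul, abs_spin]
      · simp [h1, h2]
  have e5 : ((crossing d k m).card : ℝ) * m ≤ 2 * d * ((k * m : ℕ) : ℝ) ^ d := by
    exact_mod_cast card_crossing_mul_le (d := d) (k := k) (m := m)
  have hm' : (0 : ℝ) < m := by exact_mod_cast hm
  rw [le_div_iff₀ hm']
  nlinarith

lemma energy_eq (d n : ℕ) (β h : ℝ) (g : box d n → ℝ) (σ : Config d n) :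
    energy β h g σ = β * interaction σ + h * ∑ x, g x * spin σ x := rfl

/-- A configuration on the large box is a free choice of one on each block. -/
lemma prod_partitionFn_restrictBlock (β h : ℝ) (g : box d (k * m) → ℝ) :
    ∏ y, partitionFn (d := d) (n := m) β h (restrictBlock g y) =
      ∑ σ : Config d (k * m), Real.exp (∑ y, energy (d := d) (n := m) β h (restrictBlock g y)
        (restrictBlock σ y)) := by
  simp_rw [partitionFn, Real.exp_sum]
  rw [Finset.prod_univ_sum, Fintype.piFinset_univ]
  let E : Config d (k * m) ≃ ((Fin d → Fin k) → Config d m) :=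
    ((Equiv.ofBijective _ (blockSite_bijective (d := d) (k := k) (m := m))).symm.arrowCongr
      (Equiv.refl ℤˣ)).trans (Equiv.curry _ _ _)
  exact (Fintype.sum_equiv E _ _ fun σ => rfl).symm

lemma abs_log_partitionFn_sub_sum_le (β h : ℝ) (g : box d (k * m) → ℝ) (hm : 0 < m) :
    |Real.log (partitionFn β h g) -
      ∑ y, Real.log (partitionFn (d := d) (n := m) β h (restrictBlock g y))| ≤
      |β| * (d * ((k * m : ℕ) : ℝ) ^ d / m) := by
  rw [← Real.log_prod fun y _ => (partitionFn_pos _ _ _).ne', prod_partitionFn_restrictBlock]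
  refine abs_log_sum_exp_sub_le _ _ fun σ => ?_
  have e : energy β h g σ - ∑ y, energy (d := d) (n := m) β h (restrictBlock g y)
      (restrictBlock σ y) =
      β * (interaction σ - ∑ y, interaction (d := d) (n := m) (restrictBlock σ y)) := by
    simp_rw [energy_eq]
    rw [Finset.sum_add_distrib, ← Finset.mul_sum, ← Finset.mul_sum]
    have e1 : ∑ x, g x * spin σ x = ∑ y, ∑ z : box d m, restrictBlock g y z *
        spin (restrictBlock σ y : Config d m) z := by
      rw [← Fintype.sum_prod_type' (f := fun (y : Fin d → Fin k) (z : box d m) =>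
        restrictBlock g y z * spin (restrictBlock σ y : Config d m) z)]
      exact (Fintype.sum_bijective blockSite blockSite_bijective _ _ fun p => rfl).symm
    rw [e1]
    ring
  rw [e, abs_mul]
  exact mul_le_mul_of_nonneg_left (abs_interaction_sub_le σ hm) (abs_nonneg β)

lemma integral_log_partitionFn_restrictBlock (β h : ℝ) (y : Fin d → Fin k) :
    Integrable (fun g => Real.log (partitionFn (d := d) (n := m) β h (restrictBlock g y)))
      (disorder d (k * m)) ∧
    ∫ g, Real.log (partitionFn (d := d) (n := m) β h (restrictBlock g y)) ∂(disorder d (k * m)) =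
      ∫ g, Real.log (partitionFn β h g) ∂(disorder d m) := by
  have hφ : Function.Injective fun z : box d m => blockSite (k := k) (y, z) := fun z z' hz =>
    (Prod.ext_iff.1 (blockSite_injective hz)).2
  have hmp := measurePreserving_comp_of_injective (gaussianReal 0 1) hφ
  have hint := integrable_log_partitionFn (d := d) (n := m) β h
  refine ⟨hmp.integrable_comp_of_integrable hint, ?_⟩
  have h1 := integral_map hmp.measurable.aemeasurable
    (f := fun g : box d m → ℝ => Real.log (partitionFn β h g))
    (by rw [hmp.map_eq]; exact hint.aestronglyMeasurable)
  rw [hmp.map_eq] at h1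
  exact h1.symm

lemma meanFreeEnergy_eq (d n : ℕ) (β h : ℝ) :
    meanFreeEnergy d n β h =
      (∫ g, Real.log (partitionFn β h g) ∂(disorder d n)) / ((n : ℝ) ^ d) := by
  rw [meanFreeEnergy, integral_div, card_box]
  push_cast
  rfl

/-- The error is the surface-to-volume ratio of one block. It does not depend on k, which is what
the Cauchy argument needs. -/
lemma abs_meanFreeEnergy_mul_sub_le (d : ℕ) {k m : ℕ} (hk : 0 < k) (hm : 0 < m) (β h : ℝ) :
    |meanFreeEnergy d (k * m) β h - meanFreeEnergy d m β h| ≤ |β| * d / m := by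
  have hk' : (0 : ℝ) < k := by exact_mod_cast hk
  have hm' : (0 : ℝ) < m := by exact_mod_cast hm
  have hI := integral_log_partitionFn_restrictBlock (d := d) (k := k) (m := m) β h
  have h1 : |∫ g, Real.log (partitionFn β h g) ∂(disorder d (k * m)) -
      (k : ℝ) ^ d * ∫ g, Real.log (partitionFn β h g) ∂(disorder d m)| ≤
      |β| * (d * ((k * m : ℕ) : ℝ) ^ d / m) := by
    have e : (k : ℝ) ^ d * ∫ g, Real.log (partitionFn β h g) ∂(disorder d m) =
        ∫ g, ∑ y, Real.log (partitionFn (d := d) (n := m) β h (restrictBlock g y))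
          ∂(disorder d (k * m)) := by
      rw [integral_finsetSum _ fun y _ => (hI y).1, Finset.sum_congr rfl fun y _ => (hI y).2]
      simp
    rw [e, ← integral_sub (integrable_log_partitionFn β h)
      (integrable_finsetSum _ fun y _ => (hI y).1)]
    have := norm_integral_le_of_norm_le_const (μ := disorder d (k * m))
      (f := fun g => Real.log (partitionFn β h g) -
        ∑ y, Real.log (partitionFn (d := d) (n := m) β h (restrictBlock g y)))
      (ae_of_all _ fun g => abs_log_partitionFn_sub_sum_le β h g hm)
    simpa using this
  rw [meanFreeEnergy_eq, meanFreeEnergy_eq]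
  set a := ∫ g, Real.log (partitionFn β h g) ∂(disorder d (k * m))
  set b := ∫ g, Real.log (partitionFn β h g) ∂(disorder d m)
  have hpos : (0 : ℝ) < ((k * m : ℕ) : ℝ) ^ d := by
    have : 0 < k * m := Nat.mul_pos hk hm
    positivity
  have e : a / ((k * m : ℕ) : ℝ) ^ d - b / (m : ℝ) ^ d =
      (a - (k : ℝ) ^ d * b) / ((k * m : ℕ) : ℝ) ^ d := by
    push_cast
    rw [mul_pow]
    field_simp
  rw [e, abs_div, abs_of_pos hpos, div_le_iff₀ hpos]
  refine h1.trans_eq ?_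
  ring

/-- The thermodynamic limit of the mean free energy exists. -/
lemma exists_tendsto_meanFreeEnergy (d : ℕ) (β h : ℝ) :
    ∃ p, Tendsto (fun n : ℕ => meanFreeEnergy d n β h) atTop (𝓝 p) := by
  refine cauchySeq_tendsto_of_complete ?_
  rw [Metric.cauchySeq_iff']
  intro ε hε
  obtain ⟨N, hN⟩ := exists_nat_gt (2 * (|β| * d) / ε)
  have hN0 : (0 : ℝ) < N := lt_of_le_of_lt (by positivity) hN
  have hN0' : 0 < N := by exact_mod_cast hN0
  refine ⟨N, fun n hn => ?_⟩
  -- Sides n and N are compared through their common multiple n * N; each comparison costs at most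
  -- |β| d / N, whence the 2 in the choice of N.
  have h1 := abs_meanFreeEnergy_mul_sub_le d (hN0'.trans_le hn) hN0' β h
  have h2 := abs_meanFreeEnergy_mul_sub_le d hN0' (hN0'.trans_le hn) β h
  rw [mul_comm N n] at h2
  have h3 : |β| * d / n ≤ |β| * d / N := by gcongr
  rw [div_lt_iff₀ hε] at hN
  have h4 : 2 * (|β| * d / N) < ε := by
    rw [← mul_div_assoc, div_lt_iff₀ hN0]
    linarith
  rw [Real.dist_eq]
  have h5 := abs_sub_le (meanFreeEnergy d n β h) (meanFreeEnergy d (n * N) β h)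
    (meanFreeEnergy d N β h)
  rw [abs_sub_comm (meanFreeEnergy d n β h) (meanFreeEnergy d (n * N) β h)] at h5
  linarith

end Blocks

/-! ### The limiting free energy, its singular set and the overlap -/

section Limit

variable {d : ℕ}

lemma box_nonempty (d : ℕ) {n : ℕ} (hn : 0 < n) : (box d n).Nonempty := by
  rw [← Finset.card_pos, card_box]
  exact pow_pos hn d

/-- For d = 0 the box is a single point for every n; d ≥ 1 makes the number of sites diverge. -/
lemma tendsto_sqrt_card_div (hd : 1 ≤ d) :
    Tendsto (fun n : ℕ => Real.sqrt ((box d n).card : ℝ) / ((box d n).card : ℝ)) atTop (𝓝 0) := by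
  simp_rw [Real.sqrt_div_self]
  refine tendsto_inv_atTop_zero.comp (Real.tendsto_sqrt_atTop.comp ?_)
  simp_rw [card_box]
  exact tendsto_natCast_atTop_atTop.comp (tendsto_pow_atTop (by omega))

lemma tendsto_integral_abs_freeEnergy_sub (hd : 1 ≤ d) {β h p : ℝ}
    (hp : Tendsto (fun n : ℕ => meanFreeEnergy d n β h) atTop (𝓝 p)) :
    Tendsto (fun n : ℕ => ∫ g, |freeEnergy β h g - p| ∂(disorder d n)) atTop (𝓝 0) := by
  have h1 : Tendsto (fun n : ℕ => |h| * (Real.sqrt ((box d n).card : ℝ) / ((box d n).card : ℝ)) +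
      |meanFreeEnergy d n β h - p|) atTop (𝓝 0) := by
    have h2 := ((tendsto_sqrt_card_div hd).const_mul |h|).add (hp.sub_const p).abs
    simpa using h2
  refine squeeze_zero (fun n => integral_nonneg fun g => abs_nonneg _) (fun n => ?_) h1
  have i1 := integrable_freeEnergy (d := d) (n := n) β h
  have i2 : Integrable (fun g => |freeEnergy β h g - meanFreeEnergy d n β h|) (disorder d n) :=
    (i1.sub (integrable_const _)).abs
  calc ∫ g, |freeEnergy β h g - p| ∂(disorder d n)
      ≤ ∫ g, (|freeEnergy β h g - meanFreeEnergy d n β h| + |meanFreeEnergy d n β h - p|)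
          ∂(disorder d n) :=
        integral_mono (i1.sub (integrable_const _)).abs (i2.add (integrable_const _))
          fun g => abs_sub_le _ _ _
    _ = ∫ g, |freeEnergy β h g - meanFreeEnergy d n β h| ∂(disorder d n) +
          |meanFreeEnergy d n β h - p| := by
        rw [integral_add i2 (integrable_const _)]; simp
    _ ≤ _ := by
        have := integral_abs_freeEnergy_sub_le (d := d) (n := n) β h
        rw [div_mul_eq_mul_div, mul_div_assoc] at this
        linarith

/-- Convexity turns convergence of the free energy into convergence of its derivative at points of
differentiability of the limit. -/
lemma tendsto_integral_abs_fieldEnergy_sub (hd : 1 ≤ d) {β h L : ℝ} {p : ℝ → ℝ}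
    (hp : ∀ t, Tendsto (fun n : ℕ => meanFreeEnergy d n β t) atTop (𝓝 (p t)))
    (hL : HasDerivAt p L h) :
    Tendsto (fun n : ℕ => ∫ g, |fieldEnergy β h g - L| ∂(disorder d n)) atTop (𝓝 0) := by
  rw [Metric.tendsto_atTop]
  intro ε hε
  have hL' : ∀ᶠ s in 𝓝 (0 : ℝ), |p (h + s) - p h - s * L| ≤ ε / 2 * |s| := by
    have := (hasDerivAt_iff_isLittleO_nhds_zero.1 hL).def (half_pos hε)
    simpa using this
  obtain ⟨r, hr, hball⟩ := Metric.eventually_nhds_iff.1 hL'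
  set δ := r / 2 with hδdef
  have hδ : 0 < δ := by positivity
  have hplus := hball (y := δ) (by rw [dist_zero_right, Real.norm_eq_abs, abs_of_pos hδ]; linarith)
  have hminus := hball (y := -δ) (by
    rw [dist_zero_right, Real.norm_eq_abs, abs_neg, abs_of_pos hδ]; linarith)
  rw [abs_neg, abs_of_pos hδ] at hminus
  rw [abs_of_pos hδ] at hplus
  have hlim : Tendsto (fun n : ℕ => ∫ g, |freeEnergy β (h + δ) g - p (h + δ)| ∂(disorder d n) +
      ∫ g, |freeEnergy β (h + -δ) g - p (h + -δ)| ∂(disorder d n) +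
      ∫ g, |freeEnergy β h g - p h| ∂(disorder d n)) atTop (𝓝 0) := by
    have := ((tendsto_integral_abs_freeEnergy_sub hd (hp (h + δ))).add
      (tendsto_integral_abs_freeEnergy_sub hd (hp (h + -δ)))).add
      (tendsto_integral_abs_freeEnergy_sub hd (hp h))
    simpa using this
  -- After division by δ, half of ε pays for the random fluctuations and half for the error in the
  -- difference quotients of p.
  obtain ⟨N, hN⟩ := (hlim.eventually (gt_mem_nhds
    (show (0 : ℝ) < δ * (ε / 2) by positivity))).exists_forall_of_atTop
  refine ⟨N, fun n hn => ?_⟩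
  have hNn := hN n hn
  have i1 : ∀ t, Integrable (fun g => |freeEnergy β t g - p t|) (disorder d n) := fun t =>
    ((integrable_freeEnergy (d := d) (n := n) β t).sub (integrable_const _)).abs
  have iM : Integrable (fun g => |fieldEnergy β h g - L|) (disorder d n) :=
    ((integrable_fieldEnergy (d := d) (n := n) β h).sub (integrable_const _)).abs
  -- The subgradient inequality at ±δ squeezes the field energy between two difference quotients of
  -- the random free energy, which are compared with those of p.
  have key : ∀ g : box d n → ℝ, δ * |fieldEnergy β h g - L| ≤
      |freeEnergy β (h + δ) g - p (h + δ)| + |freeEnergy β (h + -δ) g - p (h + -δ)| +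
        |freeEnergy β h g - p h| + ε / 2 * δ := by
    intro g
    have m1 := mul_fieldEnergy_le β h δ g
    have m2 := mul_fieldEnergy_le β h (-δ) g
    have a1 := abs_le.1 (le_refl |freeEnergy β (h + δ) g - p (h + δ)|)
    have a2 := abs_le.1 (le_refl |freeEnergy β (h + -δ) g - p (h + -δ)|)
    have a3 := abs_le.1 (le_refl |freeEnergy β h g - p h|)
    have b1 := abs_le.1 hplus
    have b2 := abs_le.1 hminus
    rcases abs_cases (fieldEnergy β h g - L) with ⟨hc, _⟩ | ⟨hc, _⟩ <;> rw [hc] <;> linarith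
  have hint := integral_mono (iM.const_mul δ)
    ((((i1 (h + δ)).add (i1 (h + -δ))).add (i1 h)).add (integrable_const (ε / 2 * δ))) key
  simp only [Pi.add_apply] at hint
  have i12 : Integrable (fun g => |freeEnergy β (h + δ) g - p (h + δ)| +
      |freeEnergy β (h + -δ) g - p (h + -δ)|) (disorder d n) := (i1 (h + δ)).add (i1 (h + -δ))
  have i123 : Integrable (fun g => |freeEnergy β (h + δ) g - p (h + δ)| +
      |freeEnergy β (h + -δ) g - p (h + -δ)| + |freeEnergy β h g - p h|) (disorder d n) :=
    i12.add (i1 h)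
  rw [integral_const_mul, integral_add i123 (integrable_const _), integral_add i12 (i1 h),
    integral_add (i1 _) (i1 _)] at hint
  simp only [integral_const, probReal_univ, smul_eq_mul, one_mul] at hint
  rw [Real.dist_eq, sub_zero, abs_of_nonneg (integral_nonneg fun g => abs_nonneg _)]
  refine lt_of_mul_lt_mul_left ?_ hδ.le
  linarith

/-- The limiting free energy per site. -/
noncomputable def limitFreeEnergy (d : ℕ) (β h : ℝ) : ℝ :=
  (exists_tendsto_meanFreeEnergy d β h).choose

lemma tendsto_meanFreeEnergy (d : ℕ) (β h : ℝ) :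
    Tendsto (fun n : ℕ => meanFreeEnergy d n β h) atTop (𝓝 (limitFreeEnergy d β h)) :=
  (exists_tendsto_meanFreeEnergy d β h).choose_spec

/-- The limit exists for all real β and h, so convexity holds on the whole plane and continuity
follows with no boundary to treat. -/
lemma convexOn_limitFreeEnergy (d : ℕ) :
    ConvexOn ℝ Set.univ fun z : ℝ × ℝ => limitFreeEnergy d z.1 z.2 := by
  refine ⟨convex_univ, fun z _ w _ s t hs ht hst => ?_⟩
  exact le_of_tendsto_of_tendsto' (tendsto_meanFreeEnergy d _ _)
    (((tendsto_meanFreeEnergy d z.1 z.2).const_smul s).add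
      ((tendsto_meanFreeEnergy d w.1 w.2).const_smul t))
    fun n => (convexOn_meanFreeEnergy d n).2 (Set.mem_univ z) (Set.mem_univ w) hs ht hst

lemma convexOn_limitFreeEnergy_right (d : ℕ) (β : ℝ) :
    ConvexOn ℝ Set.univ (limitFreeEnergy d β) := by
  refine ⟨convex_univ, fun a _ b _ s t hs ht hst => ?_⟩
  have h1 := (convexOn_limitFreeEnergy d).2 (Set.mem_univ (β, a)) (Set.mem_univ (β, b)) hs ht hst
  have h2 : s * β + t * β = β := by rw [← add_mul, hst, one_mul]
  simpa [h2] using h1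

lemma continuous_limitFreeEnergy (d : ℕ) :
    Continuous (Function.uncurry (limitFreeEnergy d)) :=
  continuousOn_univ.1 ((convexOn_limitFreeEnergy d).continuousOn isOpen_univ)

/-- The positive parameters at which the limiting free energy is not differentiable in `h`. -/
def singularSet (d : ℕ) : Set (ℝ × ℝ) :=
  {z | 0 < z.1 ∧ 0 < z.2 ∧ ¬ DifferentiableAt ℝ (fun t : ℝ => limitFreeEnergy d z.1 t) z.2}

lemma countable_singularSet_section (d : ℕ) (β : ℝ) : {h : ℝ | (β, h) ∈ singularSet d}.Countable :=
  (convexOn_limitFreeEnergy_right d β).countable_not_differentiableAt.mono fun _ hh => hh.2.2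

lemma measurableSet_singularSet (d : ℕ) : MeasurableSet (singularSet d) := by
  have h1 := measurableSet_of_differentiableAt_with_param ℝ (continuous_limitFreeEnergy d)
  exact (measurableSet_lt measurable_const measurable_fst).inter
    ((measurableSet_lt measurable_const measurable_snd).inter h1.compl)

/-- Fubini with countable sections; this is where measurability of the set is needed. -/
lemma volume_singularSet (d : ℕ) : volume (singularSet d) = 0 := by
  rw [Measure.volume_eq_prod, Measure.measure_prod_null (measurableSet_singularSet d)]
  exact ae_of_all _ fun β => (countable_singularSet_section d β).measure_zero volume

lemma exists_tendsto_overlapDeviation (hd : 1 ≤ d) {β h : ℝ} (hβ : 0 < β) (hh : 0 < h)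
    (hdiff : DifferentiableAt ℝ (limitFreeEnergy d β) h) :
    ∃ q ∈ Set.Icc (-1 : ℝ) 1, Tendsto (fun n : ℕ => overlapDeviation d n β h q) atTop (𝓝 0) := by
  set L := deriv (limitFreeEnergy d β) h with hLdef
  -- The solution of L = h(1 - q), the limiting form of `integral_fieldEnergy`.
  set q := 1 - L / h with hq
  have hqL : h * (1 - q) = L := by rw [hq]; field_simp; ring
  have hM := tendsto_integral_abs_fieldEnergy_sub hd (tendsto_meanFreeEnergy d β) hdiff.hasDerivAt
  rw [← hLdef, ← hqL] at hM
  have hQ : Tendsto (fun n : ℕ => ∫ g, meanOverlap β h g ∂(disorder d n)) atTop (𝓝 q) := by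
    rw [tendsto_iff_dist_tendsto_zero]
    have h1 := hM.const_mul h⁻¹
    rw [mul_zero] at h1
    refine squeeze_zero' (Eventually.of_forall fun _ => dist_nonneg) ?_ h1
    filter_upwards [eventually_gt_atTop 0] with n hn
    rw [Real.dist_eq]
    exact abs_integral_meanOverlap_sub_le hh q (box_nonempty d hn)
  refine ⟨q, ⟨?_, ?_⟩, ?_⟩
  · have : 0 ≤ q := ge_of_tendsto' hQ fun n => integral_nonneg fun g => meanOverlap_nonneg β h g
    linarith
  · refine le_of_tendsto' hQ fun n => ?_
    have := integral_mono (integrable_meanOverlap (d := d) (n := n) β h) (integrable_const 1)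
      fun g => meanOverlap_le_one β h g
    simpa using this
  · have h1 := (hM.const_mul ((1 + |q|) / h)).add ((tendsto_sqrt_card_div hd).const_mul (4 / h))
    rw [mul_zero, mul_zero, add_zero] at h1
    refine squeeze_zero' (Eventually.of_forall fun n => overlapDeviation_nonneg β h q) ?_ h1
    filter_upwards [eventually_gt_atTop 0] with n hn
    exact overlapDeviation_le_of_fieldEnergy hβ.le hh q (box_nonempty d hn)

end Limit

end RFIM

theorem theorem1p1 (d : ℕ) (hd : 1 ≤ d) :
    ∃ (p : ℝ → ℝ → ℝ) (A : Set (ℝ × ℝ)),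
      (∀ β h : ℝ, 0 < β → 0 < h →
        Tendsto (fun n : ℕ => RFIM.meanFreeEnergy d n β h) atTop (𝓝 (p β h))) ∧
      A = {z : ℝ × ℝ | 0 < z.1 ∧ 0 < z.2 ∧ ¬ DifferentiableAt ℝ (fun t : ℝ => p z.1 t) z.2} ∧
      volume A = 0 ∧
      (∀ β : ℝ, {h : ℝ | (β, h) ∈ A}.Countable) ∧
      ∀ β h : ℝ, 0 < β → 0 < h → (β, h) ∉ A →
        ∃ q ∈ Set.Icc (-1 : ℝ) 1,
          Tendsto (fun n : ℕ => RFIM.overlapDeviation d n β h q) atTop (𝓝 0) := by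
  refine ⟨RFIM.limitFreeEnergy d, RFIM.singularSet d,
    fun β h _ _ => RFIM.tendsto_meanFreeEnergy d β h, rfl, RFIM.volume_singularSet d,
    RFIM.countable_singularSet_section d, fun β h hβ hh hA => ?_⟩
  refine RFIM.exists_tendsto_overlapDeviation hd hβ hh ?_
  by_contra hnd
  exact hA ⟨hβ, hh, hnd⟩
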